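/- **Conventions.** Fix real numbers $F\ge 1$, $K\ge 0$, $G\ge 1$, $H\ge 2$. All C*-algebras and *-morphisms are unital. A seminorm defined on a subspace is extended by $\infty$ off that subspace, its domain. $S(A)$ is the state space of $A$, and $\Re a=\frac{a+a^*}2$, $\Im a=\frac{a-a^*}{2i}$. For a distance function $d$, $\mathrm{Haus}_d(A\to B)=\sup_{x\in A}\inf_{y\in B}d(x,y)$ and $\mathrm{Haus}_d(A,B)=\max\{\mathrm{Haus}_d(A\to B),\mathrm{Haus}_d(B\to A)\}$. An *$(F,K)$-quantum compact metric space* $(A,L)$ is a C*-algebra $A$ with a seminorm $L$ on a dense real subspace of the self-adjoint part of $A$, such that $L(1)=0$; $\mathrm{mk}_L(\varphi,\psi)=\sup\{|\varphi(a)-\psi(a)|:L(a)\le1\}$ is a metric on $S(A)$ inducing the weak* topology; $\max\{L(\Re(ab)),L(\Im(ab))\}\le F(L(a)\|b\|+\|a\|L(b))+K L(a)L(b)$ on the domain of $L$; and $\{L\le1\}$ is closed. A *metrical C\*-correspondence* $(M,DN,A,L,B,S)$ consists of two $(F,K)$-quantum compact metric spaces $(A,L)$, $(B,S)$, a right Hilbert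 C*-module $M$ over $B$ (inner product linear in its second variable) with a *-morphism from $A$ to the adjointable operators of $M$, and a norm $DN$ on a dense complex subspace of $M$, with $DN\ge\|\cdot\|_M$, $\{DN\le1\}$ compact, and, on the domains, $DN(a\omega)\le G(\|a\|+L(a))DN(\omega)$ and $\max\{S(\Re\langle\omega,\eta\rangle),S(\Im\langle\omega,\eta\rangle)\}\le H\,DN(\omega)DN(\eta)$. Its *pseudo-states* are the functionals $\xi\mapsto\mu(\langle\omega,\xi\rangle)$ with $\mu\in S(B)$, $DN(\omega)\le1$. A *modular quantum isometry* $(\Pi,\pi,\theta)$ from one metrical C*-correspondence to another consists of a continuous linear map $\Pi$ of the modules and *-morphisms $\pi,\theta$ of the left and right algebras, with $\Pi(a\omega)=\pi(a)\Pi(\omega)$, $\Pi(\omega b)=\Pi(\omega)\theta(b)$, $\theta(\langle\omega,\eta\rangle)=\langle\Pi\omega,\Pi\eta\rangle$, each map sending domain into domain and the (semi)norm of each element of a target domain being the infimum of the (semi)norms of its preimages. A *tunnel* $\tau$ from $X_1$ to $X_2$ is a metrical C*-correspondence $P=(J,TN,D,L_D,E,L_E)$ with modular quantum isometries $(\Pi_j,\pi_j,\theta_j):P\to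 X_j$, $j=1,2$, where $X_j$ has left algebra $A_j$ and right algebra $B_j$. Its *extent* $\chi(\tau)$ is the maximum over $j$ of $\mathrm{Haus}_{\mathrm{mk}_{L_D}}(\{\varphi\circ\pi_j:\varphi\in S(A_j)\},S(D))$ and $\mathrm{Haus}_{\mathrm{mk}_{L_E}}(\{\psi\circ\theta_j:\psi\in S(B_j)\},S(E))$. On families (over a common nonempty index set) of continuous functionals of $J$ put $d((\varphi_i),(\psi_i))=\sup_i\sup_{TN(\omega)\le1}|\varphi_i(\omega)-\psi_i(\omega)|$. For families $a=(a_i)$, $b=(b_i)$ of adjointable operators on the modules of $X_1$, $X_2$, the *separation* is $\mathrm{sep}_\tau(a,b)=\mathrm{Haus}_d(\{(\varphi\circ a_i\circ\Pi_1)_i\},\{(\psi\circ b_i\circ\Pi_2)_i\})$, with $\varphi,\psi$ ranging over the pseudo-states of $X_1$ and $X_2$; the *dispersion* is $\mathrm{disp}_\tau(a,b)=\max\{\chi(\tau),\mathrm{sep}_\tau(a,b)\}$; and the *operational propinquity* is $\Lambda^{op}(a,b)=\inf_\tau\mathrm{disp}_\tau(a,b)$ over all tunnels from $X_1$ to $X_2$.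 A single operator is regarded as a one-element family. A *metric spectral triple* $(A,\mathscr H,D)$ is a C*-algebra $A$ represented on a Hilbert space $\mathscr H$, with a self-adjoint operator $D$ on $\mathscr H$ with $D+i$ having a compact inverse, such that $(A,L)$ is a quantum compact metric space, where $L(a)=\|[D,a]\|$ for the self-adjoint $a$ with $a\,\mathrm{dom}D\subseteq\mathrm{dom}D$ and $[D,a]$ bounded. It is identified with the metrical C*-correspondence $(\mathscr H,\|\cdot\|+\|D\cdot\|,A,L,\mathbb C,0)$. For $f\in C_b(\mathbb R)$, $f(D)$ is given by the functional calculus, and $U^t=\exp(itD)$. An *$\varepsilon$-iso-iso* is a pair of maps $\varsigma_1,\varsigma_2:[0,\infty)\to[0,\infty)$ vanishing at $0$ with $\big||\varsigma_j(x)+\varsigma_j(y)-z|-|x+y-\varsigma_k(z)|\big|<\varepsilon$ for $x,y,z\in[0,1/\varepsilon]$, $\{j,k\}=\{1,2\}$. For a tunnel $\tau$ between metric spectral triples $(A_1,\mathscr H_1,D_1)$, $(A_2,\mathscr H_2,D_2)$, let $\mathrm{reach}$ be the maximum over $\{j,k\}=\{1,2\}$ of $\mathrm{Haus}_d\big(\{(\langle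 U_j^{-t}\xi,\Pi_j(\cdot)\rangle)_t\}\to\{(\langle U_k^{-\varsigma_j(t)}\eta,\Pi_k(\cdot)\rangle)_t\}\big)$, with $0\le t\le 1/\varepsilon$, $\|\xi\|+\|D_j\xi\|\le1$, $\|\eta\|+\|D_k\eta\|\le1$. The *spectral propinquity* $\Lambda^{spec}$ is the infimum of $\{\frac{\sqrt2}2\}$ and of all $\varepsilon>0$ for which there are a tunnel and an $\varepsilon$-iso-iso with $\max\{\chi(\tau),\mathrm{reach}\}<\varepsilon$. The (equivalent) metric $\Lambda^*$ is the infimum of $\{\frac{\sqrt2}2\}$ and of all $\varepsilon>0$ for which there is a tunnel $\tau$ with $\mathrm{disp}_\tau((U_1^t)_{0\le t\le1/\varepsilon},(U_2^t)_{0\le t\le1/\varepsilon})<\varepsilon$. **Theorem.** Let $(A_n,\mathscr H_n,D_n)_{n\in\mathbb N}$ be metric spectral triples converging to a metric spectral triple $(A_\infty,\mathscr H_\infty,D_\infty)$ for the spectral propinquity, with $\Lambda^*((A_n,\mathscr H_n,D_n),(A_\infty,\mathscr H_\infty,D_\infty))<\frac{\sqrt2}2$ for all $n$. Let $\mu_n>\Lambda^*((A_n,\mathscr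 H_n,D_n),(A_\infty,\mathscr H_\infty,D_\infty))$ with $\mu_n\to0$, and let $\tau_n$ be tunnels from $(A_n,\mathscr H_n,D_n)$ to $(A_\infty,\mathscr H_\infty,D_\infty)$ with $$\mathrm{disp}_{\tau_n}\big((U_n^t)_{|t|\le 1/(2\mu_n)},(U_\infty^t)_{|t|\le 1/(2\mu_n)}\big)\le\mu_n .$$ Let $f\in C_b(\mathbb R)$, let $a\in A_\infty$ with $L_\infty(a)<\infty$, let $l\ge L_\infty(a)$ be real, and for every $n$ let $b_n$ be in the target set of $a$ controlled by $l$: with $P_n$ the middle metrical C*-correspondence of $\tau_n$, whose left algebra $(\mathfrak D_n,\mathsf L_n)$ is mapped by $\pi_n$ to $A_n$ and by $\psi_n$ to $A_\infty$, there is $d_n\in\mathfrak D_n$ with $\psi_n(d_n)=a$, $\pi_n(d_n)=b_n$ and $\mathsf L_n(d_n)\le l$. Then $$\lim_{n\to\infty}\Lambda^{op}\big(b_nf(D_n),\,af(D_\infty)\big)=0\qquad\text{and}\qquad\lim_{n\to\infty}\Lambda^{op}\big(f(D_n)b_n,\,f(D_\infty)a\big)=0 .$$ -/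

import Mathlib

open scoped BoundedContinuousFunction ComplexConjugate ComplexOrder ComplexStarModule ENNReal NNReal
open Complex Filter Topology

universe u v
noncomputable section
namespace SpectralPropinquity

/-! ## The bounded continuous functional calculus of a self-adjoint operator -/

section FunctionalCalculus

variable {H : Type*} [NormedAddCommGroup H] [InnerProductSpace ℂ H] [CompleteSpace H]

/-- `R` is the (bounded, everywhere defined) inverse of `D + i`. -/
def IsResolvent (D : H →ₗ.[ℂ] H) (R : H →L[ℂ] H) : Prop :=
  (∀ ξ : H, ∃ h : R ξ ∈ D.domain, D ⟨R ξ, h⟩ + I • R ξ = ξ) ∧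
    ∀ ξ : D.domain, R (D ξ + I • (ξ : H)) = ξ

/-- The function `x ↦ (x + i)⁻¹` in `C_b(ℝ)`. -/
def resolventFn : ℝ →ᵇ ℂ :=
  BoundedContinuousFunction.ofNormedAddCommGroup (fun x : ℝ => ((x : ℂ) + I)⁻¹)
    (by
      refine Continuous.inv₀ (by fun_prop) fun x h => ?_
      simpa using congrArg Complex.im h)
    1 (by
      intro x
      rw [norm_inv]
      refine inv_le_one_of_one_le₀ ?_
      simpa using Complex.abs_im_le_norm ((x : ℂ) + I))

/-- `Φ` is the bounded continuous functional calculus `f ↦ f(D)`: the unital *-morphism from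
`C_b(ℝ)` to the bounded operators which sends `(x + i)⁻¹` to the inverse of `D + i`. For a
self-adjoint `D` it exists and is unique, see `exists_functionalCalculus` and
`IsFunctionalCalculus.unique` below. -/
def IsFunctionalCalculus (D : H →ₗ.[ℂ] H) (Φ : (ℝ →ᵇ ℂ) →⋆ₐ[ℂ] (H →L[ℂ] H)) : Prop :=
  IsResolvent D (Φ resolventFn)

/-- The function `z ↦ z f(Re (1/z))`, so that `x + i = 1/z` is sent to `(x + i)⁻¹ f(x)`. -/
def damped (f : ℝ →ᵇ ℂ) (z : ℂ) : ℂ := z * f (z⁻¹).re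

lemma damped_norm_le (f : ℝ →ᵇ ℂ) (z : ℂ) : ‖damped f z‖ ≤ ‖f‖ * ‖z‖ := by
  rw [damped, norm_mul, mul_comm]
  gcongr
  exact f.norm_coe_le_norm _

lemma damped_continuous (f : ℝ →ᵇ ℂ) : Continuous (damped f) := by
  rw [continuous_iff_continuousAt]
  intro z
  by_cases hz : z = 0
  · subst hz
    have h0 : damped f 0 = 0 := by simp [damped]
    rw [ContinuousAt, h0]
    refine squeeze_zero_norm (damped_norm_le f) ?_
    have : Continuous fun z : ℂ => ‖f‖ * ‖z‖ := by fun_prop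
    simpa using this.tendsto 0
  · unfold damped
    refine continuousAt_id.mul (f.continuous.continuousAt.comp ?_)
    exact Complex.continuous_re.continuousAt.comp (continuousAt_inv₀ hz)

lemma resolventFn_apply (x : ℝ) : resolventFn x = ((x : ℂ) + I)⁻¹ := rfl

lemma damped_resolventFn (f : ℝ →ᵇ ℂ) (x : ℝ) :
    damped f (resolventFn x) = resolventFn x * f x := by
  simp [damped, resolventFn_apply]

lemma cfc_damped_resolventFn (f : ℝ →ᵇ ℂ) : cfc (damped f) resolventFn = resolventFn * f := by
  ext x
  let ev : (ℝ →ᵇ ℂ) →⋆ₐ[ℂ] ℂ :=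
    { toFun := fun g => g x
      map_one' := rfl
      map_mul' := fun _ _ => rfl
      map_zero' := rfl
      map_add' := fun _ _ => rfl
      commutes' := fun _ => rfl
      map_star' := fun _ => rfl }
  have hev : Continuous ev := by
    change Continuous fun g : ℝ →ᵇ ℂ => g x
    fun_prop
  have h := ev.map_cfc (damped f) resolventFn (damped_continuous f).continuousOn hev
  change ev (cfc (damped f) resolventFn) = _
  have h2 : cfc (damped f) (ev resolventFn) = damped f (ev resolventFn) := by
    simpa using cfc_algebraMap (A := ℂ) (ev resolventFn) (damped f)
  rw [h, h2]
  exact damped_resolventFn f x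

namespace IsResolvent

variable {D : H →ₗ.[ℂ] H} {R : H →L[ℂ] H}

lemma dense_range (hD : IsSelfAdjoint D) (hR : IsResolvent D R) : DenseRange R :=
  hD.dense_domain.mono fun ξ hξ => ⟨_, hR.2 ⟨ξ, hξ⟩⟩

lemma symm (hD : IsSelfAdjoint D) (x y : D.domain) : inner ℂ (D x) (y : H) = inner ℂ (x : H) (D y) := by
  have h := LinearPMap.adjoint_isFormalAdjoint hD.dense_domain
  rw [LinearPMap.isSelfAdjoint_def.mp hD] at h
  exact h x y

lemma sub_adjoint (hD : IsSelfAdjoint D) (hR : IsResolvent D R) :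
    R - star R = (-2 * I) • (star R * R) := by
  ext η
  refine ext_inner_left ℂ fun ξ => ?_
  obtain ⟨h1, e1⟩ := hR.1 ξ
  obtain ⟨h2, e2⟩ := hR.1 η
  have hs := symm hD ⟨R ξ, h1⟩ ⟨R η, h2⟩
  have a1 : inner ℂ ξ (R η) = inner ℂ (D ⟨R ξ, h1⟩) (R η) - I * inner ℂ (R ξ) (R η) := by
    conv_lhs => rw [← e1]
    rw [inner_add_left, inner_smul_left]
    simp [sub_eq_add_neg]
  have a2 : inner ℂ (R ξ) η = inner ℂ (R ξ) (D ⟨R η, h2⟩) + I * inner ℂ (R ξ) (R η) := by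
    conv_lhs => rw [← e2]
    rw [inner_add_right, inner_smul_right]
  simp only [sub_apply, smul_apply,
    mul_apply_eq_comp, ContinuousLinearMap.star_eq_adjoint, inner_sub_right,
    inner_smul_right, ContinuousLinearMap.adjoint_inner_right]
  rw [a1, a2, hs]
  ring

/-- The Cayley transform `1 - 2iR` of a self-adjoint operator is surjective. -/
lemma cayley_surjective (hD : IsSelfAdjoint D) (hR : IsResolvent D R) (U : H →L[ℂ] H)
    (hU : U = 1 - (2 * I) • R) (hiso : star U * U = 1) : U * star U = 1 := by
  have hnorm : ∀ ξ, ‖U ξ‖ = ‖ξ‖ := by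
    intro ξ
    have h : inner ℂ (U ξ) (U ξ) = inner ℂ ξ ξ := by
      rw [← ContinuousLinearMap.adjoint_inner_right, ← ContinuousLinearMap.star_eq_adjoint,
        ← mul_apply_eq_comp, hiso, one_apply_eq_self]
    rw [inner_self_eq_norm_sq_to_K, inner_self_eq_norm_sq_to_K] at h
    have h' : ‖U ξ‖ ^ 2 = ‖ξ‖ ^ 2 := by exact_mod_cast h
    exact (sq_eq_sq₀ (norm_nonneg _) (norm_nonneg _)).mp h'
  have hker : ∀ η, star U η = 0 → η = 0 := by
    intro η hη
    have horth : ∀ x : D.domain, inner ℂ η (D x) = I * inner ℂ η (x : H) := by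
      intro x
      have h0 : inner ℂ η (U (D x + I • (x : H))) = 0 := by
        rw [← ContinuousLinearMap.adjoint_inner_left, ← ContinuousLinearMap.star_eq_adjoint, hη,
          inner_zero_left]
      have h1 : U (D x + I • (x : H)) = D x - I • (x : H) := by
        rw [hU, sub_apply, one_apply_eq_self,
          smul_apply, hR.2 x, mul_smul, two_smul]
        abel
      rw [h1, inner_sub_right, inner_smul_right] at h0
      exact sub_eq_zero.mp h0
    have hmem : η ∈ D.domain := by
      rw [← LinearPMap.isSelfAdjoint_def.mp hD]
      refine LinearPMap.mem_adjoint_domain_of_exists _ ⟨(-I) • η, fun x => ?_⟩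
      rw [inner_smul_left, horth x]
      simp
    have h1 := horth ⟨η, hmem⟩
    have h2 := symm hD ⟨η, hmem⟩ ⟨η, hmem⟩
    have h3 : (starRingEnd ℂ) (inner ℂ η (D ⟨η, hmem⟩)) = inner ℂ (D ⟨η, hmem⟩) η :=
      inner_conj_symm _ _
    rw [h2] at h3
    simp only [h1, map_mul, conj_I, inner_conj_symm] at h3
    have h4 : inner ℂ η η = (0 : ℂ) := by
      have h5 : (2 * I) * inner ℂ η η = (0 : ℂ) := by linear_combination -h3
      simpa using h5
    exact inner_self_eq_zero.mp h4
  ext η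
  have key : star U (U (star U η) - η) = 0 := by
    rw [map_sub, sub_eq_zero, ← mul_apply_eq_comp, hiso,
      one_apply_eq_self]
  have := hker _ key
  simpa [sub_eq_zero] using this

lemma isStarNormal (hD : IsSelfAdjoint D) (hR : IsResolvent D R) : IsStarNormal R := by
  have h := sub_adjoint hD hR
  set U : H →L[ℂ] H := 1 - (2 * I) • R with hU
  have hsU : star U = 1 + (2 * I) • star R := by
    rw [hU, star_sub, star_one, star_smul]
    simp [sub_eq_add_neg]
  have e1 : star U * U = 1 := by
    rw [hsU, hU, add_mul, one_mul, mul_sub, mul_one, smul_mul_smul_comm]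
    have : star R = R - (-2 * I) • (star R * R) := by rw [← h]; abel
    rw [show (1 - (2 * I) • R + ((2 * I) • star R - (2 * I * (2 * I)) • (star R * R)) : H →L[ℂ] H)
      = 1 - (2 * I) • (R - star R) - (2 * I * (2 * I)) • (star R * R) by
        rw [smul_sub]; abel, h, smul_smul, sub_sub, ← add_smul]
    have : (2 * I * (-2 * I) + 2 * I * (2 * I) : ℂ) = 0 := by ring
    rw [this, zero_smul, sub_zero]
  have e2 := cayley_surjective hD hR U hU e1
  have hRU : R = (2 * I)⁻¹ • (1 - U) := by
    rw [hU, sub_sub_cancel, smul_smul, inv_mul_cancel₀ (by simp), one_smul]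
  refine ⟨?_⟩
  rw [hRU, star_smul, star_sub, star_one]
  refine Commute.smul_left (Commute.smul_right ?_ _) _
  refine ((Commute.one_left _).sub_left ?_)
  refine (Commute.one_right _).sub_right ?_
  rw [commute_iff_eq, e1, e2]

lemma spectrum_im (hD : IsSelfAdjoint D) (hR : IsResolvent D R) {z : ℂ} (hz : z ∈ spectrum ℂ R) :
    z * (((z⁻¹).re : ℂ) + I)⁻¹ = z ^ 2 := by
  by_cases hz0 : z = 0
  · simp [hz0]
  have hn := isStarNormal hD hR
  have h1 : cfc (fun z : ℂ => z - star z) R = cfc (fun z : ℂ => (-2 * I) * (star z * z)) R := by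
    rw [cfc_sub (fun z : ℂ => z) (fun z : ℂ => star z) R, cfc_id' ℂ R, cfc_star_id (a := R),
      cfc_const_mul (-2 * I) (fun z : ℂ => star z * z) R,
      cfc_mul (fun z : ℂ => star z) (fun z : ℂ => z) R, cfc_id' ℂ R, cfc_star_id (a := R)]
    exact sub_adjoint hD hR
  have h2 := eqOn_of_cfc_eq_cfc h1 (by fun_prop) (by fun_prop) hn hz
  have h3 : (((z⁻¹).re : ℂ) + I) = z⁻¹ := by
    have hc : (starRingEnd ℂ) z ≠ 0 := by simpa using hz0
    have h4 : (starRingEnd ℂ) z⁻¹ - z⁻¹ = -2 * I := by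
      rw [map_inv₀]
      field_simp
      simpa [mul_comm, mul_assoc, mul_left_comm] using h2
    have h5 : (z⁻¹).im = 1 := by
      have := congrArg Complex.im h4
      simp only [Complex.sub_im, Complex.conj_im, Complex.mul_im, Complex.neg_re, Complex.neg_im,
        Complex.I_re, Complex.I_im] at this
      norm_num at this
      simp
      linarith
    apply Complex.ext <;> simp [h5]
  rw [h3, inv_inv, sq]

lemma ext_range (hD : IsSelfAdjoint D) (hR : IsResolvent D R) {S T : H →L[ℂ] H}
    (h : S * R = T * R) : S = T := by
  refine DFunLike.coe_injective ((dense_range hD hR).equalizer S.continuous T.continuous ?_)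
  funext ξ
  exact congrArg (fun A : H →L[ℂ] H => A ξ) h

lemma cfc_damped_norm_le (hD : IsSelfAdjoint D) (hR : IsResolvent D R) (f : ℝ →ᵇ ℂ) (ξ : H) :
    ‖cfc (damped f) R ξ‖ ≤ ‖f‖ * ‖R ξ‖ := by
  have hn := isStarNormal hD hR
  have hc := damped_continuous f
  let h : ℂ → ℂ := fun z => ((√(‖f‖ ^ 2 * ‖z‖ ^ 2 - ‖damped f z‖ ^ 2) : ℝ) : ℂ)
  have hh : Continuous h := by fun_prop
  have key : ∀ g : ℂ → ℂ, Continuous g → star (cfc g R) * cfc g R =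
      cfc (fun z => ((‖g z‖ ^ 2 : ℝ) : ℂ)) R := by
    intro g hg
    rw [← cfc_star, ← cfc_mul (fun z => star (g z)) g R (by fun_prop) (by fun_prop)]
    congr 1
    funext z
    simpa using Complex.conj_mul' (g z)
  have e : star (cfc (damped f) R) * cfc (damped f) R + star (cfc h R) * cfc h R =
      ((‖f‖ ^ 2 : ℝ) : ℂ) • (star R * R) := by
    have k3 := key (fun z => z) (by fun_prop)
    rw [cfc_id' ℂ R] at k3
    rw [key _ hc, key _ hh, k3, ← cfc_add R _ _ (by fun_prop) (by fun_prop),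
      ← cfc_const_mul _ _ R (by fun_prop)]
    congr 1
    funext z
    have hle : ‖damped f z‖ ^ 2 ≤ ‖f‖ ^ 2 * ‖z‖ ^ 2 := by
      rw [← mul_pow]
      exact pow_le_pow_left₀ (norm_nonneg _) (damped_norm_le f z) 2
    have hz : ‖h z‖ ^ 2 = ‖f‖ ^ 2 * ‖z‖ ^ 2 - ‖damped f z‖ ^ 2 := by
      rw [Complex.norm_real, Real.norm_of_nonneg (Real.sqrt_nonneg _),
        Real.sq_sqrt (by linarith)]
    rw [hz]
    push_cast
    ring
  have hin : ∀ S : H →L[ℂ] H, RCLike.re (inner ℂ ξ ((star S * S) ξ)) = ‖S ξ‖ ^ 2 := by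
    intro S
    rw [mul_apply_eq_comp, ContinuousLinearMap.star_eq_adjoint,
      ContinuousLinearMap.adjoint_inner_right, inner_self_eq_norm_sq]
  have e' := congrArg (fun S : H →L[ℂ] H => RCLike.re (inner ℂ ξ (S ξ))) e
  simp only [add_apply, inner_add_right, map_add, hin, smul_apply, inner_smul_right] at e'
  rw [RCLike.re_eq_complex_re, Complex.re_ofReal_mul, ← RCLike.re_eq_complex_re, hin] at e'
  refine le_of_sq_le_sq ?_ (by positivity)
  nlinarith [sq_nonneg ‖cfc h R ξ‖]

/-- The operator `f(D)`, as the continuous extension of `Rξ ↦ (f(x)(x+i)⁻¹)(D) ξ`. -/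
def op (R : H →L[ℂ] H) (f : ℝ →ᵇ ℂ) : H →L[ℂ] H :=
  (cfc (damped f) R).toLinearMap.extendOfNorm R.toLinearMap

lemma op_mul (hD : IsSelfAdjoint D) (hR : IsResolvent D R) (f : ℝ →ᵇ ℂ) :
    op R f * R = cfc (damped f) R := by
  ext ξ
  exact LinearMap.extendOfNorm_eq (dense_range hD hR) ⟨‖f‖, cfc_damped_norm_le hD hR f⟩ ξ

lemma op_comp (hD : IsSelfAdjoint D) (hR : IsResolvent D R) (f g : ℝ →ᵇ ℂ) :
    op R (f * g) = op R f * op R g := by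
  have hn := isStarNormal hD hR
  have hf := damped_continuous f
  have hg := damped_continuous g
  have hfg := damped_continuous (f * g)
  have hid : cfc (fun z : ℂ => z) R = R := cfc_id' ℂ R
  have hcomm : ∀ F : ℂ → ℂ, Continuous F → cfc F R * R = R * cfc F R := by
    intro F hF
    conv_lhs => rw [← hid, hid]
    nth_rewrite 2 [← hid]
    nth_rewrite 3 [← hid]
    rw [← cfc_mul F (fun z => z) R (by fun_prop) (by fun_prop),
      ← cfc_mul (fun z => z) F R (by fun_prop) (by fun_prop)]
    congr 1
    funext z
    exact mul_comm _ _
  refine ext_range hD hR (ext_range hD hR ?_)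
  rw [op_mul hD hR, mul_assoc (op R f), op_mul hD hR, mul_assoc, hcomm _ hg, ← mul_assoc,
    op_mul hD hR]
  nth_rewrite 2 [← hid]
  rw [← cfc_mul _ _ R (by fun_prop) (by fun_prop), ← cfc_mul _ _ R (by fun_prop) (by fun_prop)]
  congr 1
  funext z
  simp only [damped, BoundedContinuousFunction.coe_mul, Pi.mul_apply]
  ring

lemma op_add (hD : IsSelfAdjoint D) (hR : IsResolvent D R) (f g : ℝ →ᵇ ℂ) :
    op R (f + g) = op R f + op R g := by
  have hn := isStarNormal hD hR
  have hf := damped_continuous f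
  have hg := damped_continuous g
  refine ext_range hD hR ?_
  rw [add_mul, op_mul hD hR, op_mul hD hR, op_mul hD hR,
    ← cfc_add R _ _ (by fun_prop) (by fun_prop)]
  congr 1
  funext z
  simp [damped, mul_add]

lemma op_const (hD : IsSelfAdjoint D) (hR : IsResolvent D R) (c : ℂ) :
    op R (algebraMap ℂ (ℝ →ᵇ ℂ) c) = algebraMap ℂ (H →L[ℂ] H) c := by
  have hn := isStarNormal hD hR
  refine ext_range hD hR ?_
  rw [op_mul hD hR, ← Algebra.smul_def]
  nth_rewrite 2 [← cfc_id' ℂ R]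
  rw [← cfc_const_mul _ _ R (by fun_prop)]
  congr 1
  funext z
  have : (algebraMap ℂ (ℝ →ᵇ ℂ) c) (z⁻¹).re = c := by
    rw [Algebra.algebraMap_eq_smul_one]
    simp
  rw [damped, this, mul_comm]

lemma op_star (hD : IsSelfAdjoint D) (hR : IsResolvent D R) (f : ℝ →ᵇ ℂ) :
    op R (star f) = star (op R f) := by
  have hn := isStarNormal hD hR
  have hf := damped_continuous f
  have hf' := damped_continuous (star f)
  refine ext_range hD hR ?_
  have h1 : star R * (op R (star f) * R) = star R * (star (op R f) * R) := by
    have h2 : star R * (star (op R f) * R) = star (cfc (damped f) R) * R := by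
      rw [← op_mul hD hR, star_mul, mul_assoc]
    rw [h2, op_mul hD hR]
    nth_rewrite 1 [← cfc_id' ℂ R]
    nth_rewrite 4 [← cfc_id' ℂ R]
    rw [← cfc_star, ← cfc_star, ← cfc_mul _ _ R (by fun_prop) (by fun_prop),
      ← cfc_mul _ _ R (by fun_prop) (by fun_prop)]
    congr 1
    funext z
    simp only [damped, BoundedContinuousFunction.star_apply, star_mul']
    ring
  ext ξ
  refine sub_eq_zero.mp ?_
  rw [← inner_self_eq_zero (𝕜 := ℂ)]
  set v := (op R (star f) * R) ξ - (star (op R f) * R) ξ with hv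
  have h3 : star R v = 0 := by
    rw [hv, map_sub, sub_eq_zero]
    exact congrArg (fun A : H →L[ℂ] H => A ξ) h1
  have h5 : ∀ η, inner ℂ v (R η) = (0 : ℂ) := by
    intro η
    rw [← ContinuousLinearMap.adjoint_inner_left, ← ContinuousLinearMap.star_eq_adjoint, h3,
      inner_zero_left]
  have h6 : (fun w : H => inner ℂ v w) = fun _ => (0 : ℂ) :=
    (dense_range hD hR).equalizer (by fun_prop) continuous_const (funext h5)
  exact congrFun h6 v

lemma op_resolventFn (hD : IsSelfAdjoint D) (hR : IsResolvent D R) : op R resolventFn = R := by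
  have hn := isStarNormal hD hR
  refine ext_range hD hR ?_
  rw [op_mul hD hR, ← sq, ← cfc_pow_id (R := ℂ) R 2]
  exact cfc_congr fun z hz => spectrum_im hD hR hz

end IsResolvent

/-- Existence of the bounded continuous functional calculus. -/
theorem exists_functionalCalculus {D : H →ₗ.[ℂ] H} (hD : IsSelfAdjoint D)
    (hR : ∃ R : H →L[ℂ] H, IsResolvent D R) :
    ∃ Φ : (ℝ →ᵇ ℂ) →⋆ₐ[ℂ] (H →L[ℂ] H), IsFunctionalCalculus D Φ := by
  obtain ⟨R, hR⟩ := hR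
  refine ⟨
    { toFun := IsResolvent.op R
      map_one' := by simpa using IsResolvent.op_const hD hR 1
      map_mul' := IsResolvent.op_comp hD hR
      map_zero' := by simpa using IsResolvent.op_const hD hR 0
      map_add' := IsResolvent.op_add hD hR
      commutes' := IsResolvent.op_const hD hR
      map_star' := IsResolvent.op_star hD hR }, ?_⟩
  change IsResolvent D (IsResolvent.op R resolventFn)
  rwa [IsResolvent.op_resolventFn hD hR]

/-- Uniqueness of the bounded continuous functional calculus. -/
theorem IsFunctionalCalculus.unique {D : H →ₗ.[ℂ] H} (hD : IsSelfAdjoint D)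
    {Φ Ψ : (ℝ →ᵇ ℂ) →⋆ₐ[ℂ] (H →L[ℂ] H)} (hΦ : IsFunctionalCalculus D Φ)
    (hΨ : IsFunctionalCalculus D Ψ) : Φ = Ψ := by
  have hn : IsStarNormal (Φ resolventFn) := IsResolvent.isStarNormal hD hΦ
  have hn' : IsStarNormal (Ψ resolventFn) := IsResolvent.isStarNormal hD hΨ
  have hres : Φ resolventFn = Ψ resolventFn := by
    ext ξ
    obtain ⟨h1, e1⟩ := hΨ.1 ξ
    have h2 := hΦ.2 ⟨_, h1⟩
    rwa [e1] at h2
  ext1 f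
  refine IsResolvent.ext_range hD hΦ ?_
  have key : ∀ Θ : (ℝ →ᵇ ℂ) →⋆ₐ[ℂ] (H →L[ℂ] H), IsStarNormal (Θ resolventFn) →
      Θ f * Θ resolventFn = cfc (damped f) (Θ resolventFn) := by
    intro Θ hΘ
    rw [← map_mul, mul_comm, ← cfc_damped_resolventFn]
    exact Θ.map_cfc (damped f) resolventFn (damped_continuous f).continuousOn
      (AddMonoidHomClass.continuous_of_bound Θ 1 fun x => by
        simpa using NonUnitalStarAlgHom.norm_apply_le Θ x)
  rw [key Φ hn, hres, key Ψ hn']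

/-- The function `E_t : x ↦ exp(itx)` in `C_b(ℝ)`. -/
def expFn (t : ℝ) : ℝ →ᵇ ℂ :=
  BoundedContinuousFunction.ofNormedAddCommGroup (fun x : ℝ => Complex.exp (I * t * x))
    (by fun_prop) 1 (by
      intro x
      rw [show I * (t : ℂ) * (x : ℂ) = ((t * x : ℝ) : ℂ) * I by push_cast; ring,
        Complex.norm_exp_ofReal_mul_I])

end FunctionalCalculus

/-! ## Hausdorff distances -/

/-- `sup_{x ∈ A} inf_{y ∈ B} d(x, y)`. -/
def hausdorffFrom {E : Type*} (d : E → E → ℝ≥0∞) (A B : Set E) : ℝ≥0∞ :=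
  ⨆ x ∈ A, ⨅ y ∈ B, d x y

/-- The Hausdorff distance between `A` and `B` for a distance function `d`. -/
def hausdorff {E : Type*} (d : E → E → ℝ≥0∞) (A B : Set E) : ℝ≥0∞ :=
  max (hausdorffFrom d A B) (hausdorffFrom d B A)

/-! ## Quantum compact metric spaces

A seminorm `L` defined on a subspace is extended by `∞` off that subspace, so that its domain is
`{a | L a < ∞}`. -/

section QuantumMetric

variable {A : Type*} [CStarAlgebra A]

variable (A) in
/-- The state space: the positive linear functionals which send `1` to `1`, with the weak*
topology. -/
def stateSpace : Set (WeakDual ℂ A) :=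
  {φ | (∀ a : A, 0 ≤ φ (star a * a)) ∧ φ 1 = 1}

/-- The Monge-Kantorovich distance induced by `L`. -/
def kantorovich (L : A → ℝ≥0∞) (φ ψ : WeakDual ℂ A) : ℝ≥0∞ :=
  ⨆ (a : A) (_ : L a ≤ 1), ‖φ a - ψ a‖ₑ

/-- `(A, L)` is an `(F, K)`-quantum compact metric space. -/
structure IsQuantumMetric (F K : ℝ) (L : A → ℝ≥0∞) : Prop where
  isSelfAdjoint : ∀ a, L a < ∞ → IsSelfAdjoint a
  add_le : ∀ a b, L (a + b) ≤ L a + L b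
  smul_eq : ∀ (t : ℝ) (a : A), L a < ∞ → L (t • a) = ‖t‖ₑ * L a
  dense : ∀ a, IsSelfAdjoint a → a ∈ closure {b | L b < ∞}
  map_one : L 1 = 0
  /-- The Monge-Kantorovich distance is a metric which induces the weak* topology. -/
  metric : ∃ m : MetricSpace (stateSpace A),
    (∀ φ ψ : stateSpace A, ENNReal.ofReal (m.dist φ ψ) = kantorovich L φ ψ) ∧
      m.toUniformSpace.toTopologicalSpace = instTopologicalSpaceSubtype
  leibniz : ∀ a b, L a < ∞ → L b < ∞ →
    max (L (ℜ (a * b))) (L (ℑ (a * b))) ≤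
      ENNReal.ofReal F * (L a * ‖b‖ₑ + ‖a‖ₑ * L b) + ENNReal.ofReal K * L a * L b
  isClosed : IsClosed {a | L a ≤ 1}

end QuantumMetric

/-! ## Metrical C*-correspondences -/

/-- An `A`-`B`-C*-correspondence: a right Hilbert C*-module `M` over the unital C*-algebra `B`,
and a unital *-morphism from `A` to the adjointable operators on `M`. -/
structure CStarCorrespondence where
  M : Type u
  A : Type u
  B : Type v
  [normedM : NormedAddCommGroup M]
  [normedSpaceM : NormedSpace ℂ M]
  [completeM : CompleteSpace M]
  [cstarA : CStarAlgebra A]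
  [cstarB : CStarAlgebra B]
  [moduleM : Module Bᵐᵒᵖ M]
  /-- The `B`-valued inner product. -/
  ip : M → M → B
  ip_add_right : ∀ ω η ζ, ip ω (η + ζ) = ip ω η + ip ω ζ
  ip_smul_right : ∀ (z : ℂ) ω η, ip ω (z • η) = z • ip ω η
  ip_mul_right : ∀ ω η (b : B), ip ω (MulOpposite.op b • η) = ip ω η * b
  star_ip : ∀ ω η, star (ip η ω) = ip ω η
  ip_self_nonneg : ∀ ω, ∃ c : B, ip ω ω = star c * c
  ip_self_eq_zero : ∀ ω, ip ω ω = 0 ↔ ω = 0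
  norm_eq : ∀ ω, ‖ω‖ = √‖ip ω ω‖
  /-- The left action of `A`. -/
  act : A →ₐ[ℂ] (M →L[ℂ] M)
  ip_act : ∀ a ω η, ip (act a ω) η = ip ω (act (star a) η)

attribute [instance] CStarCorrespondence.normedM CStarCorrespondence.normedSpaceM
  CStarCorrespondence.completeM CStarCorrespondence.cstarA CStarCorrespondence.cstarB
  CStarCorrespondence.moduleM

/-- A C*-correspondence with (extended valued) functions `DN` on `M`, `L` on `A` and `S` on `B`;
it is a metrical C*-correspondence when `IsMetrical` below holds. -/
structure SeminormedCorrespondence extends CStarCorrespondence.{u, v} where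
  DN : M → ℝ≥0∞
  L : A → ℝ≥0∞
  S : B → ℝ≥0∞

namespace SeminormedCorrespondence

/-- `X` is an `(F, K, G, H)`-metrical C*-correspondence. -/
structure IsMetrical (F K G H : ℝ) (X : SeminormedCorrespondence.{u, v}) : Prop where
  quantumMetric_left : IsQuantumMetric F K X.L
  quantumMetric_right : IsQuantumMetric F K X.S
  add_le : ∀ ω η, X.DN (ω + η) ≤ X.DN ω + X.DN η
  smul_eq : ∀ (z : ℂ) ω, X.DN ω < ∞ → X.DN (z • ω) = ‖z‖ₑ * X.DN ω
  dense : Dense {ω | X.DN ω < ∞}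
  enorm_le : ∀ ω, ‖ω‖ₑ ≤ X.DN ω
  isCompact : IsCompact {ω | X.DN ω ≤ 1}
  modular_leibniz : ∀ a ω, X.L a < ∞ → X.DN ω < ∞ →
    X.DN (X.act a ω) ≤ ENNReal.ofReal G * (‖a‖ₑ + X.L a) * X.DN ω
  inner_leibniz : ∀ ω η, X.DN ω < ∞ → X.DN η < ∞ →
    max (X.S (ℜ (X.ip ω η))) (X.S (ℑ (X.ip ω η))) ≤ ENNReal.ofReal H * X.DN ω * X.DN η

/-- The pseudo-states `ξ ↦ μ(⟨ω, ξ⟩)`, for `μ` a state of `B` and `DN ω ≤ 1`. -/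
def pseudoStates (X : SeminormedCorrespondence.{u, v}) : Set (X.M →L[ℂ] ℂ) :=
  {φ | ∃ μ ∈ stateSpace X.B, ∃ ω, X.DN ω ≤ 1 ∧ ∀ ξ, φ ξ = μ (X.ip ω ξ)}

/-- The Monge-Kantorovich distance, induced by `DN`, between families of linear functionals. -/
def kantorovichFamily (X : SeminormedCorrespondence.{u, v}) {J : Type*}
    (φ ψ : J → X.M →L[ℂ] ℂ) : ℝ≥0∞ :=
  ⨆ (j : J) (ξ : X.M) (_ : X.DN ξ ≤ 1), ‖φ j ξ - ψ j ξ‖ₑ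

end SeminormedCorrespondence

/-- A Lipschitz morphism. -/
structure LipschitzMorphism (X Y : SeminormedCorrespondence.{u, v}) where
  onM : X.M →L[ℂ] Y.M
  onA : X.A →⋆ₐ[ℂ] Y.A
  onB : X.B →⋆ₐ[ℂ] Y.B
  map_act : ∀ a ω, onM (X.act a ω) = Y.act (onA a) (onM ω)
  map_smul : ∀ (b : X.B) ω, onM (MulOpposite.op b • ω) = MulOpposite.op (onB b) • onM ω
  map_ip : ∀ ω η, onB (X.ip ω η) = Y.ip (onM ω) (onM η)
  map_domL : ∀ a, X.L a < ∞ → Y.L (onA a) < ∞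
  map_domS : ∀ b, X.S b < ∞ → Y.S (onB b) < ∞
  map_domDN : ∀ ω, X.DN ω < ∞ → Y.DN (onM ω) < ∞

/-- A modular quantum isometry. -/
structure ModularQuantumIsometry (X Y : SeminormedCorrespondence.{u, v}) extends
    LipschitzMorphism X Y where
  L_eq : ∀ a, Y.L a < ∞ → Y.L a = ⨅ (d : X.A) (_ : onA d = a), X.L d
  S_eq : ∀ b, Y.S b < ∞ → Y.S b = ⨅ (d : X.B) (_ : onB d = b), X.S d
  DN_eq : ∀ ω, Y.DN ω < ∞ → Y.DN ω = ⨅ (η : X.M) (_ : onM η = ω), X.DN η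

/-- A (metrical) tunnel from `X` to `Y`. -/
structure Tunnel (F K G H : ℝ) (X Y : SeminormedCorrespondence.{u, v}) where
  P : SeminormedCorrespondence.{u, v}
  isMetrical : P.IsMetrical F K G H
  fst : ModularQuantumIsometry P X
  snd : ModularQuantumIsometry P Y

namespace Tunnel

variable {F K G H : ℝ} {X Y : SeminormedCorrespondence.{u, v}}

/-- The reversed tunnel. -/
def symm (τ : Tunnel F K G H X Y) : Tunnel F K G H Y X where
  P := τ.P
  isMetrical := τ.isMetrical
  fst := τ.snd
  snd := τ.fst

/-- The states `φ ∘ π` obtained by composing states with a unital *-morphism. -/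
def pullbackStates {A B : Type*} [CStarAlgebra A] [CStarAlgebra B] (π : A →⋆ₐ[ℂ] B) :
    Set (WeakDual ℂ A) :=
  {χ | ∃ φ ∈ stateSpace B, ∀ a, χ a = φ (π a)}

/-- The extent of a tunnel. -/
def extent (τ : Tunnel F K G H X Y) : ℝ≥0∞ :=
  max
    (max (hausdorff (kantorovich τ.P.L) (pullbackStates τ.fst.onA) (stateSpace τ.P.A))
      (hausdorff (kantorovich τ.P.S) (pullbackStates τ.fst.onB) (stateSpace τ.P.B)))
    (max (hausdorff (kantorovich τ.P.L) (pullbackStates τ.snd.onA) (stateSpace τ.P.A))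
      (hausdorff (kantorovich τ.P.S) (pullbackStates τ.snd.onB) (stateSpace τ.P.B)))

/-- The separation, according to a tunnel, between two families of operators. -/
def separation (τ : Tunnel F K G H X Y) {J : Type*} (a : J → X.M →L[ℂ] X.M)
    (b : J → Y.M →L[ℂ] Y.M) : ℝ≥0∞ :=
  hausdorff τ.P.kantorovichFamily
    ((fun φ j => (φ ∘L a j) ∘L τ.fst.onM) '' X.pseudoStates)
    ((fun ψ j => (ψ ∘L b j) ∘L τ.snd.onM) '' Y.pseudoStates)

/-- The dispersion, according to a tunnel, of two families of operators. -/
def dispersion (τ : Tunnel F K G H X Y) {J : Type*} (a : J → X.M →L[ℂ] X.M)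
    (b : J → Y.M →L[ℂ] Y.M) : ℝ≥0∞ :=
  max τ.extent (τ.separation a b)

/-- The target set of `a`, controlled by `l`. -/
def targetSet (τ : Tunnel F K G H X Y) (a : X.A) (l : ℝ≥0) : Set Y.A :=
  {b | ∃ d : τ.P.A, τ.fst.onA d = a ∧ τ.P.L d ≤ l ∧ τ.snd.onA d = b}

end Tunnel

/-- The operational propinquity between two families of operators, indexed by the same set. -/
def opPropinquity (F K G H : ℝ) (X Y : SeminormedCorrespondence.{u, v}) {J : Type*}
    (a : J → X.M →L[ℂ] X.M) (b : J → Y.M →L[ℂ] Y.M) : ℝ≥0∞ :=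
  ⨅ τ : Tunnel F K G H X Y, τ.dispersion a b

/-! ## Metric spectral triples -/

section Connes

variable {A E : Type*} [CStarAlgebra A] [NormedAddCommGroup E] [InnerProductSpace ℂ E]
  [CompleteSpace E]

open Classical in
/-- The seminorm `a ↦ ‖[D, a]‖`, for `a` self-adjoint with `a · dom D ⊆ dom D` and `[D, a]`
bounded, and `∞` for all other `a`. -/
def connesSeminorm (rep : A →⋆ₐ[ℂ] (E →L[ℂ] E)) (D : E →ₗ.[ℂ] E) (a : A) : ℝ≥0∞ :=
  if h : IsSelfAdjoint a ∧ ∀ ξ ∈ D.domain, rep a ξ ∈ D.domain then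
    ⨆ (ξ : D.domain) (_ : ‖ξ‖ ≤ 1), ‖D ⟨rep a ξ, h.2 ξ ξ.2⟩ - rep a (D ξ)‖ₑ
  else ∞

open Classical in
/-- The graph norm `‖ξ‖ + ‖D ξ‖` of `D`, and `∞` off the domain of `D`. -/
def graphNorm (D : E →ₗ.[ℂ] E) (ξ : E) : ℝ≥0∞ :=
  if h : ξ ∈ D.domain then ‖ξ‖ₑ + ‖D ⟨ξ, h⟩‖ₑ else ∞

end Connes

/-- A spectral triple `(A, E, D)`. -/
structure SpectralTriple where
  A : Type u
  E : Type u
  [cstarA : CStarAlgebra A]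
  [normedE : NormedAddCommGroup E]
  [innerE : InnerProductSpace ℂ E]
  [completeE : CompleteSpace E]
  rep : A →⋆ₐ[ℂ] (E →L[ℂ] E)
  D : E →ₗ.[ℂ] E
  isSelfAdjoint : IsSelfAdjoint D
  compact_resolvent : ∃ R : E →L[ℂ] E, IsResolvent D R ∧ IsCompactOperator R
  dense : ∀ a : A, IsSelfAdjoint a → a ∈ closure {b | connesSeminorm rep D b < ∞}

attribute [instance] SpectralTriple.cstarA SpectralTriple.normedE SpectralTriple.innerE
  SpectralTriple.completeE

namespace SpectralTriple

/-- The seminorm `a ↦ ‖[D, a]‖`. -/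
def L (T : SpectralTriple.{u}) : T.A → ℝ≥0∞ := connesSeminorm T.rep T.D

/-- The bounded continuous functional calculus `f ↦ f(D)`. -/
def calculus (T : SpectralTriple.{u}) : (ℝ →ᵇ ℂ) →⋆ₐ[ℂ] (T.E →L[ℂ] T.E) :=
  Classical.choose (exists_functionalCalculus T.isSelfAdjoint
    (T.compact_resolvent.imp fun _ h => h.1))

lemma isFunctionalCalculus_calculus (T : SpectralTriple.{u}) :
    IsFunctionalCalculus T.D T.calculus :=
  Classical.choose_spec (exists_functionalCalculus T.isSelfAdjoint
    (T.compact_resolvent.imp fun _ h => h.1))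

/-- The unitary operator `U^t = exp(itD)`. -/
def U (T : SpectralTriple.{u}) (t : ℝ) : T.E →L[ℂ] T.E := T.calculus (expFn t)

open Classical in
/-- The C*-correspondence `(E, ‖·‖ + ‖D·‖, A, ‖[D, ·]‖, ℂ, 0)` of a spectral triple. -/
def mcc (T : SpectralTriple.{u}) : SeminormedCorrespondence.{u, 0} where
  M := T.E
  A := T.A
  B := ℂ
  moduleM := Module.compHom T.E (RingEquiv.toOpposite ℂ).symm.toRingHom
  ip := fun ω η => inner ℂ ω η
  ip_add_right := fun _ _ _ => inner_add_right _ _ _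
  ip_smul_right := fun _ _ _ => inner_smul_right _ _ _
  ip_mul_right := fun ω η b => (inner_smul_right ω η b).trans (mul_comm _ _)
  star_ip := fun ω η => inner_conj_symm ω η
  ip_self_nonneg := fun ω => ⟨(‖ω‖ : ℂ), by
    rw [inner_self_eq_norm_sq_to_K, sq]
    simp⟩
  ip_self_eq_zero := fun _ => inner_self_eq_zero
  norm_eq := fun ω => by
    rw [inner_self_eq_norm_sq_to_K]
    simp
  act := T.rep.toAlgHom
  ip_act := fun a ω η => by
    change inner ℂ (T.rep a ω) η = inner ℂ ω (T.rep (star a) η)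
    rw [map_star, ContinuousLinearMap.star_eq_adjoint, ContinuousLinearMap.adjoint_inner_right]
  DN := graphNorm T.D
  L := T.L
  S := fun b => if IsSelfAdjoint b then 0 else ∞

end SpectralTriple

/-- A metric spectral triple: `(A, ‖[D, ·]‖)` is a quantum compact metric space. -/
structure MetricSpectralTriple extends SpectralTriple.{u} where
  isMetric : IsQuantumMetric 1 0 toSpectralTriple.L

/-! ## The spectral propinquity -/

/-- `(ς₁, ς₂)` is an `ε`-iso-iso of `[0, ∞)`. -/
def IsIsoIso (ε : ℝ) (ς₁ ς₂ : ℝ≥0 → ℝ≥0) : Prop :=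
  ς₁ 0 = 0 ∧ ς₂ 0 = 0 ∧
    ∀ x y z : ℝ≥0, (x : ℝ) ≤ 1 / ε → (y : ℝ) ≤ 1 / ε → (z : ℝ) ≤ 1 / ε →
      |(|(ς₁ x + ς₁ y - z : ℝ)| - |(x + y - ς₂ z : ℝ)|)| < ε ∧
      |(|(ς₂ x + ς₂ y - z : ℝ)| - |(x + y - ς₁ z : ℝ)|)| < ε

section Propinquity

variable {F K G H : ℝ} {T₁ T₂ : SpectralTriple.{u}}

/-- One half of the `ε`-reach of a tunnel. -/
def halfReach (τ : Tunnel F K G H T₁.mcc T₂.mcc) (ς : ℝ≥0 → ℝ≥0) (ε : ℝ) : ℝ≥0∞ :=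
  hausdorffFrom τ.P.kantorovichFamily
    {φ | ∃ ξ : T₁.E, graphNorm T₁.D ξ ≤ 1 ∧
      φ = fun t : {t : ℝ≥0 // (t : ℝ) ≤ 1 / ε} => innerSL ℂ (T₁.U (-(t : ℝ≥0)) ξ) ∘L τ.fst.onM}
    {φ | ∃ ξ : T₂.E, graphNorm T₂.D ξ ≤ 1 ∧
      φ = fun t : {t : ℝ≥0 // (t : ℝ) ≤ 1 / ε} => innerSL ℂ (T₂.U (-(ς t)) ξ) ∘L τ.snd.onM}

/-- The `ε`-reach of a tunnel with an iso-iso. -/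
def reach (τ : Tunnel F K G H T₁.mcc T₂.mcc) (ς₁ ς₂ : ℝ≥0 → ℝ≥0) (ε : ℝ) : ℝ≥0∞ :=
  max (halfReach τ ς₁ ε) (halfReach τ.symm ς₂ ε)

/-- The `ε`-magnitude of a tunnel with an iso-iso. -/
def magnitude (τ : Tunnel F K G H T₁.mcc T₂.mcc) (ς₁ ς₂ : ℝ≥0 → ℝ≥0) (ε : ℝ) : ℝ≥0∞ :=
  max τ.extent (reach τ ς₁ ς₂ ε)

/-- The dispersion of the families of all `exp(itD)`, for `t ∈ [a, b]`. -/
def unitaryDispersion (τ : Tunnel F K G H T₁.mcc T₂.mcc) (a b : ℝ) : ℝ≥0∞ :=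
  τ.dispersion (fun t : Set.Icc a b => T₁.U t) (fun t : Set.Icc a b => T₂.U t)

variable (F K G H T₁ T₂)

/-- The spectral propinquity. -/
def spectralPropinquity : ℝ :=
  sInf ({√2 / 2} ∪ {ε | 0 < ε ∧ ∃ (τ : Tunnel F K G H T₁.mcc T₂.mcc) (ς₁ ς₂ : ℝ≥0 → ℝ≥0),
    IsIsoIso ε ς₁ ς₂ ∧ magnitude τ ς₁ ς₂ ε < ENNReal.ofReal ε})

/-- The metric `Λ*`, equivalent to the spectral propinquity, in which the iso-isos are replaced by
the identity. -/
def spectralPropinquityStar : ℝ :=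
  sInf ({√2 / 2} ∪ {ε | 0 < ε ∧ ∃ τ : Tunnel F K G H T₁.mcc T₂.mcc,
    unitaryDispersion τ 0 (1 / ε) < ENNReal.ofReal ε})

end Propinquity

end SpectralPropinquity

end

/-! The given tunnels `τ n` themselves witness the convergence: their extent is at most `μ n`, so it
suffices to make the separation of the product operators small.

The only state of ℂ is the identity, so pseudo-states of a spectral triple are the functionals ⟪ω,
·⟫ with ω in the unit ball of the graph norm. Small separation of the unitary groups therefore
matches each such ω with some η on the other side, so that ⟪ω, U₁ᵗ Q₁ζ⟫ and ⟪η, U₂ᵗ Q₂ζ⟫ are close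
for |t| ≤ N and `DN ζ ≤ 1` (`PairingClose`).

From exponentials to `f`: on the graph unit ball, ξ = (D + i)⁻¹(Dξ + iξ) with ‖Dξ + iξ‖ ≤ 1, so
`f(D)` needs to be approximated only up to the weight (x + i)⁻¹. In that weighted sense `f` is a
uniform limit of trigonometric polynomials (`exists_trigonometric_near`). One polynomial serves all
`n`, and its finitely many frequencies eventually lie in the window |t| ≤ 1/(2μₙ).

From `f(D)` to products: an extent below 1 bounds ‖d‖ by ‖a‖ plus the Lipschitz bound, uniformly in
`n` (`norm_le_of_hausdorff_lt_one`). For f(D)b, one replaces ζ by dζ, whose `DN` is controlled by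
the modular Leibniz inequality. For b f(D), one moves b to the left and must compare bω with aη at
all times t. Apply the matching to bω to get η′; at t = 0 the lift d shows that η′ and aη are almost
equal against every Q₂ζ. Since η′ - aη lifts to a vector of controlled `DN`, it can be tested
against itself and is small in norm. Contractivity of U₂ᵗ then transfers this to all t
(`IsLipschitzLift.exists_pairingClose`). -/

namespace SpectralPropinquity

/-! ### States of a C*-algebra: norm-one functionals and norming states. -/

section States

variable {A : Type*} [CStarAlgebra A]

/-- Since ‖h + it‖² ≤ ‖h‖² + t², a nonzero imaginary part of `g h` would contribute a term linear in
t that no constant can dominate. -/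
lemma im_apply_eq_zero_of_norm_le_one {g : StrongDual ℂ A} (hg : ‖g‖ ≤ 1) (h1 : g 1 = 1) {h : A}
    (hh : IsSelfAdjoint h) : (g h).im = 0 := by
  have key : ∀ t : ℝ, ((g h).im + t) ^ 2 ≤ ‖h‖ ^ 2 + t ^ 2 * ‖(1 : A)‖ := by
    intro t
    set y : A := h + (t * I : ℂ) • 1 with hy
    have e1 : star y * y = h * h + ((t ^ 2 : ℝ) : ℂ) • 1 := by
      rw [hy, star_add, star_smul, star_one, hh.star_eq, add_mul, mul_add, mul_add,
        smul_mul_smul_comm, smul_mul_assoc, mul_smul_comm, one_mul, mul_one, one_mul]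
      have e2 : star (t * I : ℂ) = -(t * I) := by simp
      have e3 : -(t * I : ℂ) * (t * I) = ((t ^ 2 : ℝ) : ℂ) := by
        push_cast
        linear_combination (-(t : ℂ) ^ 2) * I_sq
      rw [e2, e3, neg_smul]
      abel
    have e2 : ‖y‖ ^ 2 ≤ ‖h‖ ^ 2 + t ^ 2 * ‖(1 : A)‖ := by
      rw [sq, ← CStarRing.norm_star_mul_self, e1]
      refine (norm_add_le _ _).trans (add_le_add ((norm_mul_le _ _).trans (sq _).ge) ?_)
      rw [norm_smul, norm_real, Real.norm_of_nonneg (sq_nonneg t)]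
    have e3 : ‖g y‖ ≤ ‖y‖ := (g.le_of_opNorm_le hg y).trans (one_mul _).le
    have e4 : (g y).im = (g h).im + t := by
      rw [hy, map_add, map_smul, h1]
      simp
    rw [← e4]
    refine le_trans ?_ e2
    rw [← sq_abs]
    exact pow_le_pow_left₀ (abs_nonneg _) ((Complex.abs_im_le_norm _).trans e3) 2
  have hone : ‖(1 : A)‖ ≤ 1 := by
    rcases subsingleton_or_nontrivial A with hA | hA
    · simp [Subsingleton.elim (1 : A) 0]
    · simp
  have key' : ∀ t : ℝ, 2 * (g h).im * t ≤ ‖h‖ ^ 2 := fun t => by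
    nlinarith [key t, mul_le_mul_of_nonneg_left hone (sq_nonneg t), sq_nonneg (g h).im]
  by_contra hne
  -- This t turns the linear bound into ‖h‖² + 1 ≤ ‖h‖².
  have := key' ((‖h‖ ^ 2 + 1) / (2 * (g h).im))
  rw [mul_div_cancel₀ _ (by simpa using hne)] at this
  linarith

open scoped CStarAlgebra in
/-- A unital contractive functional on a C*-algebra is a state. -/
lemma mem_stateSpace_of_norm_le_one {g : StrongDual ℂ A} (hg : ‖g‖ ≤ 1) (h1 : g 1 = 1) :
    StrongDual.toWeakDual g ∈ stateSpace A := by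
  let : PartialOrder A := CStarAlgebra.spectralOrder A
  have : StarOrderedRing A := CStarAlgebra.spectralOrderedRing A
  refine ⟨fun a => ?_, h1⟩
  set p := star a * a
  have hp : 0 ≤ p := star_mul_self_nonneg a
  -- From 0 ≤ p ≤ ‖p‖ the element ‖p‖ - p has norm at most ‖p‖. Hence |‖p‖ - g p| ≤ ‖p‖, which
  -- forces the real part of `g p` to be nonnegative.
  have hpn : p ≤ algebraMap ℝ A ‖p‖ := (IsSelfAdjoint.of_nonneg hp).le_algebraMap_norm_self
  have hle : ‖algebraMap ℝ A ‖p‖ - p‖ ≤ ‖p‖ := by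
    refine (CStarAlgebra.norm_le_norm_of_nonneg_of_le (sub_nonneg.mpr hpn)
      (sub_le_self _ hp)).trans ?_
    rcases subsingleton_or_nontrivial A with hA | hA
    · simp [Subsingleton.elim (algebraMap ℝ A ‖p‖) 0]
    · simp
  have h2 : ‖g (algebraMap ℝ A ‖p‖ - p)‖ ≤ ‖p‖ :=
    ((g.le_of_opNorm_le hg _).trans (one_mul _).le).trans hle
  have h3 : g (algebraMap ℝ A ‖p‖ - p) = ‖p‖ - g p := by
    rw [map_sub, Algebra.algebraMap_eq_smul_one, ← Complex.coe_smul, map_smul, h1]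
    simp
  have h4 := (Complex.re_le_norm _).trans (h3 ▸ h2)
  change 0 ≤ g p
  rw [Complex.nonneg_iff]
  refine ⟨?_, (im_apply_eq_zero_of_norm_le_one hg h1 (.of_nonneg hp)).symm⟩
  simpa using h4

/-- The norm of a self-adjoint element is attained at a state. -/
lemma exists_state_norm_eq {d : A} (hd : IsSelfAdjoint d) (h0 : d ≠ 0) :
    ∃ φ ∈ stateSpace A, ‖φ d‖ = ‖d‖ := by
  have hA : Nontrivial A := ⟨d, 0, h0⟩
  have key : ∀ e : A, (‖e‖ : ℝ) ∈ spectrum ℝ e → e ≠ 0 → ∃ φ ∈ stateSpace A, ‖φ e‖ = ‖e‖ := by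
    intro e he hne
    have hpos : 0 < ‖e‖ := norm_pos_iff.mpr hne
    -- A norming functional of ‖e‖ + e, whose norm is at least 2‖e‖, has no slack: ‖e‖ g(1) + g(e)
    -- reaches 2‖e‖ only if g(1) = 1 and g(e) = ‖e‖.
    set x : A := algebraMap ℝ A ‖e‖ + e
    have hx : 2 * ‖e‖ ≤ ‖x‖ := by
      have : ‖e‖ + ‖e‖ ∈ spectrum ℝ x := by
        rw [spectrum.add_mem_add_iff]
        exact he
      have := spectrum.norm_le_norm_of_mem this
      rw [Real.norm_of_nonneg (by positivity)] at this
      linarith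
    obtain ⟨g, hg, hgx⟩ := exists_dual_vector ℂ x (show 0 < ‖x‖ by linarith).ne'
    have e1 : g x = ‖e‖ * g 1 + g e := by
      rw [map_add, Algebra.algebraMap_eq_smul_one, ← Complex.coe_smul, map_smul]
      simp
    have e2 : ‖g 1‖ ≤ 1 := by simpa [hg] using g.le_opNorm 1
    have e3 : ‖g e‖ ≤ ‖e‖ := by simpa [hg] using g.le_opNorm e
    have e4 : ‖e‖ * (g 1).re + (g e).re = ‖x‖ := by
      have := congrArg Complex.re (e1.symm.trans hgx)
      simpa using this
    have e5 := Complex.re_le_norm (g 1)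
    have e6 := Complex.re_le_norm (g e)
    have e7 : 1 ≤ (g 1).re := by
      by_contra! hlt
      nlinarith
    have e8 : g 1 = 1 := by
      have h9 := Complex.sq_norm (g 1)
      rw [Complex.normSq_apply] at h9
      have h10 : ‖g 1‖ ^ 2 ≤ 1 := pow_le_one₀ (norm_nonneg _) e2
      have h11 : (g 1).im = 0 := by nlinarith
      apply Complex.ext
      · simpa using le_antisymm (e5.trans e2) e7
      · simpa using h11
    refine ⟨_, mem_stateSpace_of_norm_le_one hg.le e8, le_antisymm e3 ?_⟩
    refine le_trans ?_ e6
    have : (g 1).re = 1 := by simp [e8]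
    rw [this] at e4
    linarith
  rcases CStarAlgebra.norm_or_neg_norm_mem_spectrum (a := d) hd with h | h
  · exact key d h h0
  · obtain ⟨φ, hφ, h'⟩ := key (-d) (by
      rw [norm_neg, ← spectrum.neg_eq, Set.mem_neg]
      exact h) (neg_ne_zero.mpr h0)
    exact ⟨φ, hφ, by rwa [map_neg, norm_neg, norm_neg] at h'⟩

end States

/-! ### Weighted approximation by trigonometric polynomials. -/

section Trigonometric

/-- The trigonometric polynomial with the given frequencies and coefficients. -/
noncomputable def trigonometric (c : ℝ →₀ ℂ) : ℝ →ᵇ ℂ := c.sum fun t z => z • expFn t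

lemma expFn_apply (t x : ℝ) : expFn t x = Complex.exp (I * t * x) := rfl

lemma norm_expFn_le (t : ℝ) : ‖expFn t‖ ≤ 1 :=
  BoundedContinuousFunction.norm_ofNormedAddCommGroup_le _ zero_le_one _

open Set in
/-- A bounded continuous function agrees on `[-r, r]` with a continuous periodic function which has
the same bound. -/
lemma exists_periodic_agree (f : ℝ →ᵇ ℂ) {r : ℝ} (hr : 0 < r) :
    ∃ h : C(AddCircle (2 * (r + 1)), ℂ), (∀ x : ℝ, |x| ≤ r → h x = f x) ∧ ∀ y, ‖h y‖ ≤ ‖f‖ := by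
  have : Fact (0 < 2 * (r + 1)) := ⟨by positivity⟩
  -- The cutoff is 1 on [-r, r] and vanishes at ±(r + 1), so the ends of the period match.
  set k : ℝ → ℂ := fun x => f x * ((max 0 (min 1 (r + 1 - |x|)) : ℝ) : ℂ)
  have hk : Continuous k := by fun_prop
  have hkn : ∀ x, ‖k x‖ ≤ ‖f‖ := by
    intro x
    rw [norm_mul, Complex.norm_real, Real.norm_of_nonneg (le_max_left _ _)]
    refine (mul_le_of_le_one_right (norm_nonneg _) ?_).trans (f.norm_coe_le_norm x)
    simp
  have hend : k (-(r + 1)) = k (-(r + 1) + 2 * (r + 1)) := by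
    have e : -(r + 1) + 2 * (r + 1) = r + 1 := by ring
    simp [k, e, abs_of_pos (show 0 < r + 1 by linarith), -neg_add_rev, abs_neg]
  refine ⟨⟨AddCircle.liftIco (2 * (r + 1)) (-(r + 1)) k,
    AddCircle.liftIco_continuous hend hk.continuousOn⟩, fun x hx => ?_, fun y => ?_⟩
  · obtain ⟨h1, h2⟩ := abs_le.mp hx
    change AddCircle.liftIco (2 * (r + 1)) (-(r + 1)) k x = f x
    rw [AddCircle.liftIco_coe_apply ⟨by linarith, by linarith⟩]
    have : max 0 (min 1 (r + 1 - |x|)) = 1 := by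
      rw [min_eq_left (by linarith), max_eq_right zero_le_one]
    simp [k, this]
  · obtain ⟨x, hx, rfl⟩ : ∃ x ∈ Ico (-(r + 1)) (-(r + 1) + 2 * (r + 1)), (x : AddCircle _) = y :=
      ⟨_, (AddCircle.equivIco _ (-(r + 1)) y).2, AddCircle.coe_equivIco⟩
    change ‖AddCircle.liftIco (2 * (r + 1)) (-(r + 1)) k x‖ ≤ ‖f‖
    rw [AddCircle.liftIco_coe_apply hx]
    exact hkn x

/-- Every continuous periodic function is a uniform limit of trigonometric polynomials. -/
lemma exists_trigonometric_near_periodic {p : ℝ} (hp : 0 < p) (h : C(AddCircle p, ℂ)) {δ : ℝ}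
    (hδ : 0 < δ) : ∃ c : ℝ →₀ ℂ, ∀ x : ℝ, ‖h x - trigonometric c x‖ ≤ δ := by
  have : Fact (0 < p) := ⟨hp⟩
  have hmem : h ∈ (Submodule.span ℂ (Set.range (@fourier p))).topologicalClosure := by
    rw [span_fourier_closure_eq_top]
    trivial
  obtain ⟨q, hq, hd⟩ := Metric.mem_closure_iff.mp hmem δ hδ
  obtain ⟨c, rfl⟩ := Finsupp.mem_span_range_iff_exists_finsupp.mp hq
  -- The n-th Fourier monomial of period p is the exponential of frequency 2πn/p.
  refine ⟨c.mapDomain fun n : ℤ => 2 * Real.pi * n / p, fun x => ?_⟩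
  have e : trigonometric (c.mapDomain fun n : ℤ => 2 * Real.pi * n / p) x =
      (c.sum fun n z => z • @fourier p n) (x : AddCircle p) := by
    rw [trigonometric, Finsupp.sum_mapDomain_index (by simp) (by simp [add_smul]), Finsupp.sum,
      Finsupp.sum, BoundedContinuousFunction.sum_apply, ContinuousMap.sum_apply]
    refine Finset.sum_congr rfl fun n _ => ?_
    rw [BoundedContinuousFunction.smul_apply, ContinuousMap.smul_apply, fourier_coe_apply,
      expFn_apply]
    congr 2
    push_cast
    ring
  rw [e]
  refine le_trans ?_ hd.le
  rw [dist_eq_norm]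
  exact ContinuousMap.norm_coe_le_norm (h - _) (x : AddCircle p)

/-- Relative to the weight `(x + i)⁻¹`, bounded continuous functions are uniform limits of
trigonometric polynomials. -/
lemma exists_trigonometric_near (f : ℝ →ᵇ ℂ) {δ : ℝ} (hδ : 0 < δ) :
    ∃ c : ℝ →₀ ℂ, ‖(f - trigonometric c) * resolventFn‖ ≤ δ := by
  -- Beyond r the error is only known to be at most 2‖f‖ + δ = δr, but there |x + i| ≥ |x| > r
  -- absorbs it.
  set r : ℝ := (2 * ‖f‖ + δ) / δ
  have hr : 0 < r := by positivity
  obtain ⟨h, h1, h2⟩ := exists_periodic_agree f hr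
  obtain ⟨c, hc⟩ := exists_trigonometric_near_periodic (by positivity) h hδ
  refine ⟨c, (BoundedContinuousFunction.norm_le hδ.le).mpr fun x => ?_⟩
  rw [BoundedContinuousFunction.mul_apply, norm_mul, resolventFn_apply, norm_inv,
    BoundedContinuousFunction.sub_apply]
  have hre : |x| ≤ ‖(x : ℂ) + I‖ := by simpa using Complex.abs_re_le_norm ((x : ℂ) + I)
  have him : 1 ≤ ‖(x : ℂ) + I‖ := by simpa using Complex.abs_im_le_norm ((x : ℂ) + I)
  rw [← div_eq_mul_inv, div_le_iff₀ (by linarith)]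
  rcases le_or_gt |x| r with hx | hx
  · rw [← h1 x hx]
    exact (hc x).trans (le_mul_of_one_le_right hδ.le him)
  · have e1 : ‖f x - trigonometric c x‖ ≤ 2 * ‖f‖ + δ := by
      calc ‖f x - trigonometric c x‖ = ‖f x - h x + (h x - trigonometric c x)‖ := by
            congr 1; ring
        _ ≤ ‖f x‖ + ‖h x‖ + ‖h x - trigonometric c x‖ :=
            (norm_add_le _ _).trans (by gcongr; exact norm_sub_le _ _)
        _ ≤ ‖f‖ + ‖f‖ + δ := by
            gcongr
            exacts [f.norm_coe_le_norm x, h2 _, hc x]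
        _ = _ := by ring
    refine e1.trans ?_
    calc 2 * ‖f‖ + δ = δ * r := by simp only [r]; field_simp
      _ ≤ δ * ‖(x : ℂ) + I‖ := by gcongr; exact hx.le.trans hre

end Trigonometric

/-! ### The graph norm and its behaviour under Lipschitz elements. -/

section GraphNorm

variable {A E : Type*} [CStarAlgebra A] [NormedAddCommGroup E] [InnerProductSpace ℂ E]
  {D : E →ₗ.[ℂ] E}

lemma graphNorm_le_ofReal_iff {ξ : E} {r : ℝ} (hr : 0 ≤ r) :
    graphNorm D ξ ≤ ENNReal.ofReal r ↔ ∃ h : ξ ∈ D.domain, ‖ξ‖ + ‖D ⟨ξ, h⟩‖ ≤ r := by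
  rw [graphNorm]
  split_ifs with h
  · rw [← ofReal_norm, ← ofReal_norm, ← ENNReal.ofReal_add (norm_nonneg _) (norm_nonneg _),
      ENNReal.ofReal_le_ofReal_iff hr]
    exact ⟨fun h' => ⟨h, h'⟩, fun h' => h'.2⟩
  · simp [h]

lemma graphNorm_smul_le {ξ : E} {r : ℝ} (hr : 0 ≤ r) (h : graphNorm D ξ ≤ ENNReal.ofReal r)
    (z : ℂ) : graphNorm D (z • ξ) ≤ ENNReal.ofReal (‖z‖ * r) := by
  obtain ⟨h1, h2⟩ := (graphNorm_le_ofReal_iff hr).mp h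
  refine (graphNorm_le_ofReal_iff (by positivity)).mpr ⟨D.domain.smul_mem z h1, ?_⟩
  have e : D ⟨z • ξ, D.domain.smul_mem z h1⟩ = z • D ⟨ξ, h1⟩ := D.map_smul z ⟨ξ, h1⟩
  rw [e, norm_smul, norm_smul, ← mul_add]
  gcongr

lemma graphNorm_sub_le {ξ η : E} {r s : ℝ} (hr : 0 ≤ r) (hs : 0 ≤ s)
    (h : graphNorm D ξ ≤ ENNReal.ofReal r) (h' : graphNorm D η ≤ ENNReal.ofReal s) :
    graphNorm D (ξ - η) ≤ ENNReal.ofReal (r + s) := by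
  obtain ⟨h1, h2⟩ := (graphNorm_le_ofReal_iff hr).mp h
  obtain ⟨h3, h4⟩ := (graphNorm_le_ofReal_iff hs).mp h'
  refine (graphNorm_le_ofReal_iff (by positivity)).mpr ⟨D.domain.sub_mem h1 h3, ?_⟩
  have e : D ⟨ξ - η, D.domain.sub_mem h1 h3⟩ = D ⟨ξ, h1⟩ - D ⟨η, h3⟩ :=
    D.map_sub ⟨ξ, h1⟩ ⟨η, h3⟩
  rw [e]
  linarith [norm_sub_le ξ η, norm_sub_le (D ⟨ξ, h1⟩) (D ⟨η, h3⟩)]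

variable [CompleteSpace E]

lemma isSelfAdjoint_of_connesSeminorm_lt_top {rep : A →⋆ₐ[ℂ] (E →L[ℂ] E)} {b : A}
    (h : connesSeminorm rep D b < ∞) : IsSelfAdjoint b := by
  rw [connesSeminorm] at h
  split_ifs at h with h'
  · exact h'.1
  · simp at h

lemma norm_commutator_le {rep : A →⋆ₐ[ℂ] (E →L[ℂ] E)} {b : A} {l : ℝ} (hl : 0 ≤ l)
    (h : connesSeminorm rep D b ≤ ENNReal.ofReal l) {ξ : E} (hξ : ξ ∈ D.domain) :
    ∃ h' : rep b ξ ∈ D.domain, ‖D ⟨rep b ξ, h'⟩ - rep b (D ⟨ξ, hξ⟩)‖ ≤ l * ‖ξ‖ := by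
  rw [connesSeminorm] at h
  split_ifs at h with hb
  · refine ⟨hb.2 ξ hξ, ?_⟩
    by_cases h0 : ξ = 0
    · subst h0
      have e1 : D ⟨0, hξ⟩ = 0 := D.map_zero
      have e2 : D ⟨rep b 0, hb.2 0 hξ⟩ = 0 := by
        have : (⟨rep b 0, hb.2 0 hξ⟩ : D.domain) = 0 := Subtype.ext (map_zero _)
        rw [this, D.map_zero]
      rw [e1, e2]
      simp
    have hpos : 0 < ‖ξ‖ := norm_pos_iff.mpr h0
    -- The seminorm is a supremum over the unit ball of the domain, so ξ is normalised first.
    set z : ℂ := ((‖ξ‖⁻¹ : ℝ) : ℂ) with hz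
    have hzn : ‖z‖ = ‖ξ‖⁻¹ := by
      rw [hz, Complex.norm_real, Real.norm_of_nonneg (by positivity)]
    set y : D.domain := z • ⟨ξ, hξ⟩
    have hy : ‖y‖ ≤ 1 := by
      rw [norm_smul, hzn]
      exact (inv_mul_cancel₀ hpos.ne').le
    have h1 := (le_iSup₂ (f := fun (ξ : D.domain) (_ : ‖ξ‖ ≤ 1) =>
      ‖D ⟨rep b ξ, hb.2 ξ ξ.2⟩ - rep b (D ξ)‖ₑ) y hy).trans h
    have e1 : D ⟨rep b y, hb.2 y y.2⟩ = z • D ⟨rep b ξ, hb.2 ξ hξ⟩ := by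
      rw [← D.map_smul]
      congr 1
      exact Subtype.ext (map_smul _ _ _)
    have e2 : D y = z • D ⟨ξ, hξ⟩ := D.map_smul _ _
    rw [e1, e2, map_smul, ← smul_sub, ← ofReal_norm, ENNReal.ofReal_le_ofReal_iff hl, norm_smul,
      hzn, inv_mul_le_iff₀ hpos] at h1
    rwa [mul_comm]
  · simp at h

/-- From D b ξ = b D ξ + [D, b] ξ, with the commutator bounded by l. -/
lemma graphNorm_rep_le {rep : A →⋆ₐ[ℂ] (E →L[ℂ] E)} {b : A} {l M r : ℝ} (hl : 0 ≤ l)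
    (h : connesSeminorm rep D b ≤ ENNReal.ofReal l) (hM : ‖b‖ ≤ M) (hr : 0 ≤ r) {ξ : E}
    (hξ : graphNorm D ξ ≤ ENNReal.ofReal r) :
    graphNorm D (rep b ξ) ≤ ENNReal.ofReal ((M + l) * r) := by
  have hM0 := (norm_nonneg b).trans hM
  obtain ⟨h1, h2⟩ := (graphNorm_le_ofReal_iff hr).mp hξ
  obtain ⟨h3, h4⟩ := norm_commutator_le hl h h1
  refine (graphNorm_le_ofReal_iff (by positivity)).mpr ⟨h3, ?_⟩
  have hb : ∀ x, ‖rep b x‖ ≤ M * ‖x‖ := fun x =>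
    (rep b).le_of_opNorm_le ((NonUnitalStarAlgHom.norm_apply_le rep b).trans hM) x
  have h5 := norm_sub_norm_le (D ⟨rep b ξ, h3⟩) (rep b (D ⟨ξ, h1⟩))
  have h6 := hb ξ
  have h7 := hb (D ⟨ξ, h1⟩)
  nlinarith [norm_nonneg ξ, norm_nonneg (D ⟨ξ, h1⟩)]

end GraphNorm

/-! ### Functional calculus on the graph unit ball. -/

namespace SpectralTriple

variable (T : SpectralTriple.{u})

lemma norm_calculus_le (f : ℝ →ᵇ ℂ) : ‖T.calculus f‖ ≤ ‖f‖ :=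
  NonUnitalStarAlgHom.norm_apply_le T.calculus f

lemma norm_U_apply_le (t : ℝ) (ξ : T.E) : ‖T.U t ξ‖ ≤ ‖ξ‖ :=
  ((T.U t).le_of_opNorm_le ((T.norm_calculus_le _).trans (norm_expFn_le t)) ξ).trans (one_mul _).le

lemma U_zero : T.U 0 = 1 := by
  have : expFn 0 = 1 := by
    ext x
    simp [expFn_apply]
  rw [U, this, map_one]

lemma calculus_trigonometric_apply (c : ℝ →₀ ℂ) (ξ : T.E) :
    T.calculus (trigonometric c) ξ = c.sum fun t z => z • T.U t ξ := by
  simp [trigonometric, Finsupp.sum, map_sum, U]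

/-- Writing ξ = (D + i)⁻¹(Dξ + iξ) transfers the resolvent factor to g, and ‖Dξ + iξ‖ is at most the
graph norm. This is why weighted approximation of `f` suffices. -/
lemma norm_calculus_apply_le {g : ℝ →ᵇ ℂ} {δ : ℝ} (hg : ‖g * resolventFn‖ ≤ δ) {ξ : T.E}
    (hξ : graphNorm T.D ξ ≤ 1) : ‖T.calculus g ξ‖ ≤ δ := by
  rw [← ENNReal.ofReal_one, graphNorm_le_ofReal_iff zero_le_one] at hξ
  obtain ⟨h1, h2⟩ := hξ
  have e : T.calculus g ξ = T.calculus (g * resolventFn) (T.D ⟨ξ, h1⟩ + I • ξ) := by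
    rw [map_mul, mul_apply_eq_comp, T.isFunctionalCalculus_calculus.2 ⟨ξ, h1⟩]
  rw [e]
  refine (ContinuousLinearMap.le_of_opNorm_le_of_le _ ((T.norm_calculus_le _).trans hg)
    (b := 1) ?_).trans (mul_one _).le
  refine (norm_add_le _ _).trans ?_
  rw [norm_smul, Complex.norm_I, one_mul]
  linarith

end SpectralTriple

/-! ### Comparing pairings across a tunnel. -/

section Pairing

variable {P : SeminormedCorrespondence.{u, 0}} {T T₁ T₂ : SpectralTriple.{u}}

/-- `Q` maps the domain of `P.DN` into the domain of `D`, and the graph norm of `D` is the quotient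
of `P.DN` by `Q`. -/
structure IsGraphQuotient (P : SeminormedCorrespondence.{u, 0}) (T : SpectralTriple.{u})
    (Q : P.M →L[ℂ] T.E) : Prop where
  graphNorm_le : ∀ ζ, graphNorm T.D (Q ζ) ≤ P.DN ζ
  exists_lift : ∀ ξ r, graphNorm T.D ξ < r → ∃ ζ, Q ζ = ξ ∧ P.DN ζ < r

lemma ModularQuantumIsometry.isGraphQuotient (m : ModularQuantumIsometry P T.mcc) :
    IsGraphQuotient P T m.onM where
  graphNorm_le ζ := by
    by_cases h : P.DN ζ < ∞
    · exact (m.DN_eq _ (m.map_domDN ζ h)).trans_le (iInf₂_le (f := fun η _ => P.DN η) ζ rfl)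
    · rw [not_lt_top_iff.mp h]
      exact le_top
  -- The quotient norm is used only as an infimum, hence the strict inequalities.
  exists_lift ξ r h := by
    have h' : (⨅ (η : P.M) (_ : m.onM η = ξ), P.DN η) < r :=
      (m.DN_eq ξ (h.trans_le le_top)).symm.trans_lt h
    simp only [iInf_lt_iff, exists_prop] at h'
    exact h'

/-- The functionals `⟪ω, exp(itD₁) Q₁ ·⟫` and `⟪η, exp(itD₂) Q₂ ·⟫` are within `ε` of each other on
the unit ball of `P.DN`, for all times `|t| ≤ N`. -/
def PairingClose (Q₁ : P.M →L[ℂ] T₁.E) (Q₂ : P.M →L[ℂ] T₂.E) (N ε : ℝ) (ω : T₁.E) (η : T₂.E) :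
    Prop :=
  ∀ t : ℝ, |t| ≤ N → ∀ ζ, P.DN ζ ≤ 1 →
    ‖inner ℂ ω (T₁.U t (Q₁ ζ)) - inner ℂ η (T₂.U t (Q₂ ζ))‖ ≤ ε

lemma SeminormedCorrespondence.IsMetrical.DN_inv_smul_le_one {F K G H : ℝ}
    (hP : P.IsMetrical F K G H) {ζ : P.M} {r : ℝ} (hr : 0 < r) (hζ : P.DN ζ ≤ ENNReal.ofReal r) :
    P.DN (((r⁻¹ : ℝ) : ℂ) • ζ) ≤ 1 := by
  rw [hP.smul_eq _ _ (hζ.trans_lt ENNReal.ofReal_lt_top)]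
  calc ‖((r⁻¹ : ℝ) : ℂ)‖ₑ * P.DN ζ ≤ ENNReal.ofReal r⁻¹ * ENNReal.ofReal r := by
        gcongr
        rw [← ofReal_norm, Complex.norm_real, Real.norm_of_nonneg (by positivity)]
    _ = 1 := by
        rw [← ENNReal.ofReal_mul (by positivity), inv_mul_cancel₀ hr.ne', ENNReal.ofReal_one]

/-- A bound on the unit ball of `P.DN` for the difference of two functionals scales. -/
lemma norm_pairing_le_of_DN_le {F K G H : ℝ} (hP : P.IsMetrical F K G H)
    {E₁ E₂ : Type*} [NormedAddCommGroup E₁] [InnerProductSpace ℂ E₁] [NormedAddCommGroup E₂]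
    [InnerProductSpace ℂ E₂] {S₁ : P.M →L[ℂ] E₁} {S₂ : P.M →L[ℂ] E₂} {ω : E₁} {η : E₂} {ε : ℝ}
    (h : ∀ ζ, P.DN ζ ≤ 1 → ‖inner ℂ ω (S₁ ζ) - inner ℂ η (S₂ ζ)‖ ≤ ε) {r : ℝ} (hr : 0 < r)
    {ζ : P.M} (hζ : P.DN ζ ≤ ENNReal.ofReal r) :
    ‖inner ℂ ω (S₁ ζ) - inner ℂ η (S₂ ζ)‖ ≤ r * ε := by
  have h1 := h _ (hP.DN_inv_smul_le_one hr hζ)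
  rw [map_smul, map_smul, inner_smul_right, inner_smul_right, ← mul_sub, norm_mul,
    Complex.norm_real, Real.norm_of_nonneg (by positivity), inv_mul_le_iff₀ hr] at h1
  exact h1

lemma SeminormedCorrespondence.IsMetrical.DN_act_le {F K G H : ℝ} (hP : P.IsMetrical F K G H)
    (hG : 0 ≤ G) {d : P.A} {l M : ℝ} (hl : 0 ≤ l) (hd : P.L d ≤ ENNReal.ofReal l) (hM : ‖d‖ ≤ M)
    {ζ : P.M} (hζ : P.DN ζ ≤ 1) : P.DN (P.act d ζ) ≤ ENNReal.ofReal (G * (M + l)) := by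
  have hM0 := (norm_nonneg d).trans hM
  calc P.DN (P.act d ζ) ≤ ENNReal.ofReal G * (‖d‖ₑ + P.L d) * P.DN ζ :=
        hP.modular_leibniz d ζ (hd.trans_lt ENNReal.ofReal_lt_top)
          (hζ.trans_lt ENNReal.one_lt_top)
    _ ≤ ENNReal.ofReal G * (ENNReal.ofReal M + ENNReal.ofReal l) * 1 := by
        gcongr
        rw [← ofReal_norm]
        exact ENNReal.ofReal_le_ofReal hM
    _ = ENNReal.ofReal (G * (M + l)) := by
        rw [mul_one, ← ENNReal.ofReal_add hM0 hl, ← ENNReal.ofReal_mul hG]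

/-- The vector v is itself some Qζ with `DN ζ < r + 1`, so the hypothesis can be applied to v paired
with itself. The added 1 leaves room for a lift that only almost attains the infimum. -/
lemma norm_sq_le_of_forall_norm_inner_le {Q : P.M →L[ℂ] T.E} (hQ : IsGraphQuotient P T Q)
    {F K G H : ℝ} (hP : P.IsMetrical F K G H) {v : T.E} {r ε : ℝ} (hr : 0 ≤ r)
    (hv : graphNorm T.D v ≤ ENNReal.ofReal r)
    (h : ∀ ζ, P.DN ζ ≤ 1 → ‖inner ℂ v (Q ζ)‖ ≤ ε) : ‖v‖ ^ 2 ≤ (r + 1) * ε := by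
  obtain ⟨ζ, hζ, hζr⟩ := hQ.exists_lift v (ENNReal.ofReal (r + 1))
    (hv.trans_lt ((ENNReal.ofReal_lt_ofReal_iff (by linarith)).mpr (by linarith)))
  have h1 := norm_pairing_le_of_DN_le hP (S₁ := Q) (S₂ := Q) (ω := v) (η := 0) (ε := ε)
    (by simpa using h) (by linarith) hζr.le
  rw [hζ, inner_zero_left, sub_zero, inner_self_eq_norm_sq_to_K, norm_pow] at h1
  simpa using h1

lemma PairingClose.exists_scaled {Q₁ : P.M →L[ℂ] T₁.E} {Q₂ : P.M →L[ℂ] T₂.E} {N ε : ℝ}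
    (h : ∀ ω, graphNorm T₁.D ω ≤ 1 → ∃ η, graphNorm T₂.D η ≤ 1 ∧ PairingClose Q₁ Q₂ N ε ω η)
    {r : ℝ} (hr : 0 < r) {ω : T₁.E} (hω : graphNorm T₁.D ω ≤ ENNReal.ofReal r) :
    ∃ η, graphNorm T₂.D η ≤ ENNReal.ofReal r ∧ PairingClose Q₁ Q₂ N (r * ε) ω η := by
  have hinv : ‖((r⁻¹ : ℝ) : ℂ)‖ = r⁻¹ := by
    rw [Complex.norm_real, Real.norm_of_nonneg (by positivity)]
  have hn : ‖(r : ℂ)‖ = r := by rw [Complex.norm_real, Real.norm_of_nonneg hr.le]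
  obtain ⟨η, hη, hc⟩ := h (((r⁻¹ : ℝ) : ℂ) • ω) (by
    have := graphNorm_smul_le hr.le hω ((r⁻¹ : ℝ) : ℂ)
    rwa [hinv, inv_mul_cancel₀ hr.ne', ENNReal.ofReal_one] at this)
  refine ⟨(r : ℂ) • η, ?_, fun t ht ζ hζ => ?_⟩
  · rw [← ENNReal.ofReal_one] at hη
    simpa [hn, abs_of_pos hr] using graphNorm_smul_le zero_le_one hη (r : ℂ)
  · have h1 := hc t ht ζ hζ
    rw [inner_smul_left, Complex.conj_ofReal] at h1
    rw [inner_smul_left, Complex.conj_ofReal]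
    have e : inner ℂ ω (T₁.U t (Q₁ ζ)) - r * inner ℂ η (T₂.U t (Q₂ ζ)) =
        r * (((r⁻¹ : ℝ) : ℂ) * inner ℂ ω (T₁.U t (Q₁ ζ)) - inner ℂ η (T₂.U t (Q₂ ζ))) := by
      have : (r : ℂ) ≠ 0 := by exact_mod_cast hr.ne'
      push_cast
      field_simp
    rw [e, norm_mul, hn]
    gcongr

lemma inner_rep_left {b : T.A} (hb : IsSelfAdjoint b) (ξ η : T.E) :
    inner ℂ (T.rep b ξ) η = inner ℂ ξ (T.rep b η) := by
  rw [← ContinuousLinearMap.adjoint_inner_right, ← ContinuousLinearMap.star_eq_adjoint,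
    ← map_star, hb.star_eq]

/-- `d` acts on `P` as a lift of the self-adjoint elements `b` and `a`, all of them with norm at
most `M` and seminorm at most `l`. -/
structure IsLipschitzLift (Q₁ : P.M →L[ℂ] T₁.E) (Q₂ : P.M →L[ℂ] T₂.E) (d : P.A) (b : T₁.A)
    (a : T₂.A) (M l : ℝ) : Prop where
  nonneg : 0 ≤ l
  norm_le : ‖d‖ ≤ M
  norm_left_le : ‖b‖ ≤ M
  norm_right_le : ‖a‖ ≤ M
  L_le : P.L d ≤ ENNReal.ofReal l
  L_left_le : T₁.L b ≤ ENNReal.ofReal l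
  L_right_le : T₂.L a ≤ ENNReal.ofReal l
  map_left : ∀ ζ, Q₁ (P.act d ζ) = T₁.rep b (Q₁ ζ)
  map_right : ∀ ζ, Q₂ (P.act d ζ) = T₂.rep a (Q₂ ζ)

namespace IsLipschitzLift

variable {Q₁ : P.M →L[ℂ] T₁.E} {Q₂ : P.M →L[ℂ] T₂.E} {d : P.A} {b : T₁.A} {a : T₂.A} {M l : ℝ}

lemma symm (h : IsLipschitzLift Q₁ Q₂ d b a M l) : IsLipschitzLift Q₂ Q₁ d a b M l where
  nonneg := h.nonneg
  norm_le := h.norm_le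
  norm_left_le := h.norm_right_le
  norm_right_le := h.norm_left_le
  L_le := h.L_le
  L_left_le := h.L_right_le
  L_right_le := h.L_left_le
  map_left := h.map_right
  map_right := h.map_left

/-- The bound for the pairings of `b ω` and `a η` if those of `ω` and `η` differ by at most `ε`;
`C` bounds the domain norms of `b ω`, `a η` and `d ζ` on unit balls. -/
lemma exists_pairingClose {F K G H : ℝ} (hP : P.IsMetrical F K G H) (hG : 1 ≤ G)
    (h : IsLipschitzLift Q₁ Q₂ d b a M l) (hQ₂ : IsGraphQuotient P T₂ Q₂) {C : ℝ}
    (hC : G * (M + l + 1) = C) {N ε : ℝ} (hN : 0 ≤ N)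
    (hε : ∀ ω, graphNorm T₁.D ω ≤ 1 → ∃ η, graphNorm T₂.D η ≤ 1 ∧ PairingClose Q₁ Q₂ N ε ω η)
    {ω : T₁.E} (hω : graphNorm T₁.D ω ≤ 1) :
    ∃ η, graphNorm T₂.D η ≤ 1 ∧ PairingClose Q₁ Q₂ N ε ω η ∧
      PairingClose Q₁ Q₂ N (C * ε + √((2 * C + 1) * (2 * C * ε))) (T₁.rep b ω) (T₂.rep a η) := by
  have hl := h.nonneg
  have hM : 0 ≤ M := (norm_nonneg d).trans h.norm_le
  have hC1 : M + l ≤ C := by nlinarith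
  have hC2 : G * (M + l) ≤ C := by nlinarith
  -- The summand 1 in C keeps it positive when M = l = 0, so that rescaling by C is possible.
  have hC0 : 0 < C := by rw [← hC]; positivity
  have hsa : IsSelfAdjoint b :=
    isSelfAdjoint_of_connesSeminorm_lt_top (h.L_left_le.trans_lt ENNReal.ofReal_lt_top)
  have hsa' : IsSelfAdjoint a :=
    isSelfAdjoint_of_connesSeminorm_lt_top (h.L_right_le.trans_lt ENNReal.ofReal_lt_top)
  obtain ⟨η, hη, hωη⟩ := hε ω hω
  have hrep : ∀ {T : SpectralTriple.{u}} {c : T.A} {ξ : T.E}, ‖c‖ ≤ M →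
      T.L c ≤ ENNReal.ofReal l → graphNorm T.D ξ ≤ 1 →
      graphNorm T.D (T.rep c ξ) ≤ ENNReal.ofReal C := by
    intro T c ξ h1 h2 h3
    rw [← ENNReal.ofReal_one] at h3
    exact (graphNorm_rep_le hl h2 h1 zero_le_one h3).trans
      (ENNReal.ofReal_le_ofReal (by linarith))
  -- The match η′ of bω is good at all times but unrelated to a; the rest shows that it is close in
  -- norm to aη.
  obtain ⟨η', hη', hbω⟩ := PairingClose.exists_scaled hε hC0
    (hrep h.norm_left_le h.L_left_le hω)
  have hv := graphNorm_sub_le hC0.le hC0.le hη' (hrep h.norm_right_le h.L_right_le hη)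
  have hsmall : ∀ ζ, P.DN ζ ≤ 1 → ‖inner ℂ (η' - T₂.rep a η) (Q₂ ζ)‖ ≤ 2 * C * ε := by
    intro ζ hζ
    have h0 : |(0 : ℝ)| ≤ N := by simpa
    have h1 := hbω 0 h0 ζ hζ
    -- The closeness of ω and η at t = 0 is evaluated at dζ, and self-adjointness then moves b and a
    -- to the left.
    have h2 := norm_pairing_le_of_DN_le hP (S₁ := Q₁) (S₂ := Q₂) (ε := ε)
      (fun ζ hζ => by simpa [SpectralTriple.U_zero] using hωη 0 h0 ζ hζ) hC0
      ((hP.DN_act_le (by linarith) hl h.L_le h.norm_le hζ).trans (ENNReal.ofReal_le_ofReal hC2))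
    rw [h.map_left, h.map_right, ← inner_rep_left hsa, ← inner_rep_left hsa'] at h2
    simp only [SpectralTriple.U_zero, one_apply_eq_self] at h1
    rw [inner_sub_left]
    calc _ = ‖(inner ℂ (T₁.rep b ω) (Q₁ ζ) - inner ℂ (T₂.rep a η) (Q₂ ζ)) -
          (inner ℂ (T₁.rep b ω) (Q₁ ζ) - inner ℂ η' (Q₂ ζ))‖ := by congr 1; ring
      _ ≤ C * ε + C * ε := (norm_sub_le _ _).trans (add_le_add h2 h1)
      _ = _ := by ring
  have hnorm := norm_sq_le_of_forall_norm_inner_le hQ₂ hP (by positivity) hv hsmall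
  rw [← two_mul] at hnorm
  refine ⟨η, hη, hωη, fun t ht ζ hζ => ?_⟩
  have h3 : ‖T₂.U t (Q₂ ζ)‖ ≤ 1 := by
    have := (hQ₂.graphNorm_le ζ).trans hζ
    rw [← ENNReal.ofReal_one, graphNorm_le_ofReal_iff zero_le_one] at this
    obtain ⟨_, h4⟩ := this
    exact (T₂.norm_U_apply_le t _).trans ((le_add_of_nonneg_right (norm_nonneg _)).trans h4)
  calc _ = ‖(inner ℂ (T₁.rep b ω) (T₁.U t (Q₁ ζ)) - inner ℂ η' (T₂.U t (Q₂ ζ))) +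
        inner ℂ (η' - T₂.rep a η) (T₂.U t (Q₂ ζ))‖ := by rw [inner_sub_left]; congr 1; ring
    _ ≤ C * ε + ‖η' - T₂.rep a η‖ * 1 := by
        refine (norm_add_le _ _).trans (add_le_add (hbω t ht ζ hζ) ((norm_inner_le_norm _ _).trans ?_))
        gcongr
    _ ≤ _ := by
        rw [mul_one]
        gcongr
        exact Real.le_sqrt_of_sq_le hnorm

end IsLipschitzLift

/-- Close pairings for the unitary groups give close pairings for the functional calculus. -/
lemma PairingClose.norm_calculus_le {Q₁ : P.M →L[ℂ] T₁.E} {Q₂ : P.M →L[ℂ] T₂.E} {N ε : ℝ}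
    {ω : T₁.E} {η : T₂.E} (h : PairingClose Q₁ Q₂ N ε ω η) (hQ₁ : IsGraphQuotient P T₁ Q₁)
    (hQ₂ : IsGraphQuotient P T₂ Q₂) {f : ℝ →ᵇ ℂ} {c : ℝ →₀ ℂ} {δ M : ℝ}
    (hc : ‖(f - trigonometric c) * resolventFn‖ ≤ δ) (hN : ∀ t ∈ c.support, |t| ≤ N)
    (hω : ‖ω‖ ≤ M) (hη : ‖η‖ ≤ M) {ζ : P.M} (hζ : P.DN ζ ≤ 1) :
    ‖inner ℂ ω (T₁.calculus f (Q₁ ζ)) - inner ℂ η (T₂.calculus f (Q₂ ζ))‖ ≤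
      2 * M * δ + (∑ t ∈ c.support, ‖c t‖) * ε := by
  have hM : 0 ≤ M := (norm_nonneg ω).trans hω
  set g := trigonometric c
  -- Qζ lies in the graph unit ball, so the approximation error is measured with the resolvent
  -- weight.
  have key : ∀ {T : SpectralTriple.{u}} {Q : P.M →L[ℂ] T.E} {ξ : T.E}, IsGraphQuotient P T Q →
      ‖ξ‖ ≤ M → ‖inner ℂ ξ (T.calculus (f - g) (Q ζ))‖ ≤ M * δ := by
    intro T Q ξ hQ hξ
    refine (norm_inner_le_norm _ _).trans ?_
    gcongr
    exact T.norm_calculus_apply_le hc ((hQ.graphNorm_le ζ).trans hζ)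
  have htrig : ‖inner ℂ ω (T₁.calculus g (Q₁ ζ)) - inner ℂ η (T₂.calculus g (Q₂ ζ))‖ ≤
      (∑ t ∈ c.support, ‖c t‖) * ε := by
    rw [T₁.calculus_trigonometric_apply, T₂.calculus_trigonometric_apply, Finsupp.sum, Finsupp.sum,
      inner_sum, inner_sum, ← Finset.sum_sub_distrib, Finset.sum_mul]
    refine norm_sum_le_of_le _ fun t ht => ?_
    rw [inner_smul_right, inner_smul_right, ← mul_sub, norm_mul]
    gcongr
    exact h t (hN t ht) ζ hζ
  have h1 := key hQ₁ hω
  have h2 := key hQ₂ hη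
  rw [map_sub, sub_apply, inner_sub_right] at h1 h2
  calc _ = ‖(inner ℂ ω (T₁.calculus f (Q₁ ζ)) - inner ℂ ω (T₁.calculus g (Q₁ ζ))) -
        (inner ℂ η (T₂.calculus f (Q₂ ζ)) - inner ℂ η (T₂.calculus g (Q₂ ζ))) +
        (inner ℂ ω (T₁.calculus g (Q₁ ζ)) - inner ℂ η (T₂.calculus g (Q₂ ζ)))‖ := by
        congr 1; ring
    _ ≤ (M * δ + M * δ) + (∑ t ∈ c.support, ‖c t‖) * ε :=
        (norm_add_le _ _).trans (add_le_add ((norm_sub_le _ _).trans (add_le_add h1 h2)) htrig)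
    _ = _ := by ring

end Pairing

/-! ### Unfolding one-sided Hausdorff distances. -/

section Hausdorff

lemma exists_lt_of_hausdorffFrom_lt {E : Type*} {d : E → E → ℝ≥0∞} {A B : Set E} {r : ℝ≥0∞}
    (h : hausdorffFrom d A B < r) {x : E} (hx : x ∈ A) : ∃ y ∈ B, d x y < r := by
  have h1 := (le_iSup₂ (f := fun x (_ : x ∈ A) => ⨅ y ∈ B, d x y) x hx).trans_lt h
  simpa only [iInf_lt_iff, exists_prop] using h1

lemma hausdorffFrom_le {E : Type*} {d : E → E → ℝ≥0∞} {A B : Set E} {r : ℝ≥0∞}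
    (h : ∀ x ∈ A, ∃ y ∈ B, d x y ≤ r) : hausdorffFrom d A B ≤ r :=
  iSup₂_le fun x hx => by
    obtain ⟨y, hy, hd⟩ := h x hx
    exact (iInf₂_le y hy).trans hd

end Hausdorff

/-! ### Separation in terms of vectors of the graph unit ball. -/

section Separation

variable {F K G H : ℝ} {T T₁ T₂ : SpectralTriple.{u}}

lemma stateSpace_complex_apply {μ : WeakDual ℂ ℂ} (hμ : μ ∈ stateSpace ℂ) (z : ℂ) : μ z = z := by
  have h := μ.map_smul z (1 : ℂ)
  rw [smul_eq_mul, mul_one] at h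
  exact h.trans ((congrArg (z * ·) hμ.2).trans (mul_one z))

lemma id_mem_stateSpace : StrongDual.toWeakDual (ContinuousLinearMap.id ℂ ℂ) ∈ stateSpace ℂ :=
  ⟨fun z => star_mul_self_nonneg z, rfl⟩

/-- The right algebra is ℂ, whose only state is the identity. -/
lemma SpectralTriple.mem_pseudoStates_mcc {φ : T.E →L[ℂ] ℂ} :
    φ ∈ T.mcc.pseudoStates ↔ ∃ ω : T.E, graphNorm T.D ω ≤ 1 ∧ ∀ ξ, φ ξ = inner ℂ ω ξ := by
  constructor
  · rintro ⟨μ, hμ, ω, hω, h⟩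
    exact ⟨ω, hω, fun ξ => (h ξ).trans (stateSpace_complex_apply hμ _)⟩
  · rintro ⟨ω, hω, h⟩
    exact ⟨_, id_mem_stateSpace, ω, hω, h⟩

/-- The functionals `⟪ω, S₁ Q₁ ·⟫` and `⟪η, S₂ Q₂ ·⟫` are within `ε` on the unit ball of the
domain norm of the tunnel, for all members of two families of operators. -/
def FamilyClose (τ : Tunnel F K G H T₁.mcc T₂.mcc) {J : Type*} (S₁ : J → T₁.E →L[ℂ] T₁.E)
    (S₂ : J → T₂.E →L[ℂ] T₂.E) (ε : ℝ) (ω : T₁.E) (η : T₂.E) : Prop :=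
  ∀ j ζ, τ.P.DN ζ ≤ 1 →
    ‖inner ℂ ω (S₁ j (τ.fst.onM ζ)) - inner ℂ η (S₂ j (τ.snd.onM ζ))‖ ≤ ε

variable {τ : Tunnel F K G H T₁.mcc T₂.mcc} {J : Type*} {S₁ : J → T₁.E →L[ℂ] T₁.E}
  {S₂ : J → T₂.E →L[ℂ] T₂.E} {ε : ℝ}

lemma kantorovichFamily_le_iff (hε : 0 ≤ ε) {P : SeminormedCorrespondence.{u, v}}
    {φ ψ : J → P.M →L[ℂ] ℂ} : P.kantorovichFamily φ ψ ≤ ENNReal.ofReal ε ↔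
      ∀ j ζ, P.DN ζ ≤ 1 → ‖φ j ζ - ψ j ζ‖ ≤ ε := by
  simp only [SeminormedCorrespondence.kantorovichFamily, iSup_le_iff, ← ofReal_norm,
    ENNReal.ofReal_le_ofReal_iff hε]

/-- The strict bound is what produces an actual partner from the infimum in the Hausdorff distance.
-/
lemma exists_familyClose_of_separation_lt (hε : 0 ≤ ε)
    (h : τ.separation S₁ S₂ < ENNReal.ofReal ε) :
    (∀ ω, graphNorm T₁.D ω ≤ 1 → ∃ η, graphNorm T₂.D η ≤ 1 ∧ FamilyClose τ S₁ S₂ ε ω η) ∧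
      ∀ η, graphNorm T₂.D η ≤ 1 → ∃ ω, graphNorm T₁.D ω ≤ 1 ∧ FamilyClose τ S₁ S₂ ε ω η := by
  have h := max_lt_iff.mp h
  constructor
  · intro ω hω
    obtain ⟨_, ⟨ψ, hψ, rfl⟩, hd⟩ := exists_lt_of_hausdorffFrom_lt h.1
      ⟨innerSL ℂ (E := T₁.E) ω, SpectralTriple.mem_pseudoStates_mcc.mpr ⟨ω, hω, fun _ => rfl⟩, rfl⟩
    obtain ⟨η, hη, hψη⟩ := SpectralTriple.mem_pseudoStates_mcc.mp hψ
    refine ⟨η, hη, fun j ζ hζ => ?_⟩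
    rw [← hψη]
    exact (kantorovichFamily_le_iff hε).mp hd.le j ζ hζ
  · intro η hη
    obtain ⟨_, ⟨φ, hφ, rfl⟩, hd⟩ := exists_lt_of_hausdorffFrom_lt h.2
      ⟨innerSL ℂ (E := T₂.E) η, SpectralTriple.mem_pseudoStates_mcc.mpr ⟨η, hη, fun _ => rfl⟩, rfl⟩
    obtain ⟨ω, hω, hφω⟩ := SpectralTriple.mem_pseudoStates_mcc.mp hφ
    refine ⟨ω, hω, fun j ζ hζ => ?_⟩
    rw [← hφω, norm_sub_rev]
    exact (kantorovichFamily_le_iff hε).mp hd.le j ζ hζ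

lemma separation_le_of_exists_familyClose (hε : 0 ≤ ε)
    (h₁ : ∀ ω, graphNorm T₁.D ω ≤ 1 → ∃ η, graphNorm T₂.D η ≤ 1 ∧ FamilyClose τ S₁ S₂ ε ω η)
    (h₂ : ∀ η, graphNorm T₂.D η ≤ 1 → ∃ ω, graphNorm T₁.D ω ≤ 1 ∧ FamilyClose τ S₁ S₂ ε ω η) :
    τ.separation S₁ S₂ ≤ ENNReal.ofReal ε := by
  refine max_le (hausdorffFrom_le ?_) (hausdorffFrom_le ?_)
  · rintro _ ⟨φ, hφ, rfl⟩
    obtain ⟨ω, hω, hφω⟩ := SpectralTriple.mem_pseudoStates_mcc.mp hφ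
    obtain ⟨η, hη, hc⟩ := h₁ ω hω
    refine ⟨_, ⟨innerSL ℂ (E := T₂.E) η, SpectralTriple.mem_pseudoStates_mcc.mpr ⟨η, hη, fun _ => rfl⟩, rfl⟩,
      (kantorovichFamily_le_iff hε).mpr fun j ζ hζ => ?_⟩
    have := hc j ζ hζ
    rw [← hφω] at this
    exact this
  · rintro _ ⟨ψ, hψ, rfl⟩
    obtain ⟨η, hη, hψη⟩ := SpectralTriple.mem_pseudoStates_mcc.mp hψ
    obtain ⟨ω, hω, hc⟩ := h₂ η hη
    refine ⟨_, ⟨innerSL ℂ (E := T₁.E) ω, SpectralTriple.mem_pseudoStates_mcc.mpr ⟨ω, hω, fun _ => rfl⟩, rfl⟩,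
      (kantorovichFamily_le_iff hε).mpr fun j ζ hζ => ?_⟩
    have := hc j ζ hζ
    rw [← hψη, norm_sub_rev] at this
    exact this

end Separation

/-! ### Norm control of lifts through the extent. -/

section Extent

variable {A B : Type*} [CStarAlgebra A] [CStarAlgebra B]

open scoped CStarAlgebra in
-- Apply positivity to ‖y‖ - y and y + ‖y‖.
lemma norm_apply_le_of_mem_stateSpace {φ : WeakDual ℂ A} (hφ : φ ∈ stateSpace A) {y : A}
    (hy : IsSelfAdjoint y) : ‖φ y‖ ≤ ‖y‖ := by
  let : PartialOrder A := CStarAlgebra.spectralOrder A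
  have : StarOrderedRing A := CStarAlgebra.spectralOrderedRing A
  have hpos : ∀ p : A, 0 ≤ p → 0 ≤ φ p := fun p hp => by
    obtain ⟨c, rfl⟩ := CStarAlgebra.nonneg_iff_eq_star_mul_self.mp hp
    exact hφ.1 c
  have hone : φ (algebraMap ℝ A ‖y‖) = ‖y‖ := by
    rw [Algebra.algebraMap_eq_smul_one, ← Complex.coe_smul, map_smul, hφ.2]
    simp
  have h1 := hpos _ (sub_nonneg.mpr hy.le_algebraMap_norm_self)
  have h2 := hpos _ (sub_nonneg.mpr hy.neg_algebraMap_norm_le_self)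
  rw [map_sub, hone, Complex.nonneg_iff] at h1
  rw [map_sub, map_neg, hone, Complex.nonneg_iff] at h2
  simp only [Complex.sub_re, Complex.sub_im, Complex.neg_re, Complex.neg_im, Complex.ofReal_re,
    Complex.ofReal_im] at h1 h2
  have him : (φ y).im = 0 := by linarith [h1.2]
  have hre : φ y = ((φ y).re : ℂ) := Complex.ext rfl him
  rw [hre, Complex.norm_real, Real.norm_eq_abs, abs_le]
  exact ⟨by linarith [h2.1], by linarith [h1.1]⟩

/-- An element is controlled in norm by its image under a *-morphism, if every state is close to
one which factors through that morphism. -/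
lemma norm_le_of_hausdorff_lt_one {F K : ℝ} {L : A → ℝ≥0∞} (hL : IsQuantumMetric F K L)
    {π : A →⋆ₐ[ℂ] B} (h : hausdorff (kantorovich L) (Tunnel.pullbackStates π) (stateSpace A) < 1) {d : A}
    {l : ℝ} (hl : 0 < l) (hd : L d ≤ ENNReal.ofReal l) : ‖d‖ ≤ ‖π d‖ + l := by
  have hfin : L d < ∞ := hd.trans_lt ENNReal.ofReal_lt_top
  have hsa := hL.isSelfAdjoint d hfin
  by_cases h0 : d = 0
  · rw [h0, norm_zero]
    positivity
  obtain ⟨φ, hφ, hφd⟩ := exists_state_norm_eq hsa h0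
  -- A state norming d is within distance 1 of one of the form ψ ∘ π. On d, rescaled by l, they
  -- differ by at most l.
  obtain ⟨χ, ⟨ψ, hψ, hχ⟩, hlt⟩ := exists_lt_of_hausdorffFrom_lt ((le_max_right _ _).trans_lt h) hφ
  have hscaled : L (l⁻¹ • d) ≤ 1 := by
    rw [hL.smul_eq _ _ hfin]
    calc ‖l⁻¹‖ₑ * L d ≤ ENNReal.ofReal l⁻¹ * ENNReal.ofReal l := by
          gcongr
          rw [← ofReal_norm, Real.norm_of_nonneg (by positivity)]
      _ = 1 := by
          rw [← ENNReal.ofReal_mul (by positivity), inv_mul_cancel₀ hl.ne', ENNReal.ofReal_one]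
  have h1 := (le_iSup₂ (f := fun a (_ : L a ≤ 1) => ‖φ a - χ a‖ₑ) _ hscaled).trans hlt.le
  rw [← ofReal_norm, ENNReal.ofReal_le_one, ← Complex.coe_smul, map_smul, map_smul, ← smul_sub,
    norm_smul, Complex.norm_real, Real.norm_of_nonneg (by positivity), inv_mul_le_iff₀ hl,
    mul_one] at h1
  have h2 : ‖χ d‖ ≤ ‖π d‖ := by
    rw [hχ]
    exact norm_apply_le_of_mem_stateSpace hψ (hsa.map π)
  calc ‖d‖ = ‖χ d + (φ d - χ d)‖ := by rw [add_sub_cancel, hφd]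
    _ ≤ _ := (norm_add_le _ _).trans (add_le_add h2 h1)

end Extent

/-! ### Separation estimates for the products, and the limit. -/

section Main

variable {F K G H : ℝ} {T₁ T₂ : SpectralTriple.{u}}

lemma PairingClose.symm {P : SeminormedCorrespondence.{u, 0}} {Q₁ : P.M →L[ℂ] T₁.E}
    {Q₂ : P.M →L[ℂ] T₂.E} {N ε : ℝ} {ω : T₁.E} {η : T₂.E} (h : PairingClose Q₁ Q₂ N ε ω η) :
    PairingClose Q₂ Q₁ N ε η ω := fun t ht ζ hζ => by
  rw [norm_sub_rev]
  exact h t ht ζ hζ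

lemma ModularQuantumIsometry.L_le {X Y : SeminormedCorrespondence.{u, v}}
    (m : ModularQuantumIsometry X Y) (d : X.A) : Y.L (m.onA d) ≤ X.L d := by
  by_cases h : X.L d < ∞
  · exact (m.L_eq _ (m.map_domL d h)).trans_le (iInf₂_le (f := fun d _ => X.L d) d rfl)
  · rw [not_lt_top_iff.mp h]
    exact le_top

/-- The norm of d is controlled from the side of a; that of b follows because *-morphisms contract.
The bound involves only a and l, so it is the same for a whole sequence of tunnels. -/
lemma Tunnel.isLipschitzLift (τ : Tunnel F K G H T₁.mcc T₂.mcc) {d : τ.P.A} {b : T₁.A} {a : T₂.A}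
    (hb : τ.fst.onA d = b) (ha : τ.snd.onA d = a) {l : ℝ} (hl : 0 < l)
    (hd : τ.P.L d ≤ ENNReal.ofReal l) (hτ : τ.extent < 1) :
    IsLipschitzLift τ.fst.onM τ.snd.onM d b a (‖a‖ + l) l := by
  have hM : ‖d‖ ≤ ‖a‖ + l := by
    rw [← ha]
    refine norm_le_of_hausdorff_lt_one τ.isMetrical.quantumMetric_left ?_ hl hd
    exact ((le_max_left _ _).trans (le_max_right _ _)).trans_lt hτ
  exact
    { nonneg := hl.le
      norm_le := hM
      norm_left_le := by
        rw [← hb]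
        exact (NonUnitalStarAlgHom.norm_apply_le τ.fst.onA d).trans hM
      norm_right_le := by linarith
      L_le := hd
      L_left_le := by
        rw [← hb]
        exact (τ.fst.L_le d).trans hd
      L_right_le := by
        rw [← ha]
        exact (τ.snd.L_le d).trans hd
      map_left := fun ζ => by
        rw [← hb]
        exact τ.fst.map_act d ζ
      map_right := fun ζ => by
        rw [← ha]
        exact τ.snd.map_act d ζ }

section Bounds

variable {P : SeminormedCorrespondence.{u, 0}} {Q₁ : P.M →L[ℂ] T₁.E} {Q₂ : P.M →L[ℂ] T₂.E}
  {d : P.A} {b : T₁.A} {a : T₂.A} {M l : ℝ} {f : ℝ →ᵇ ℂ} {c : ℝ →₀ ℂ} {δ N ε : ℝ} {ω : T₁.E}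
  {η : T₂.E}

lemma norm_le_one_of_graphNorm_le_one {E : Type*} [NormedAddCommGroup E] [InnerProductSpace ℂ E]
    {D : E →ₗ.[ℂ] E} {ξ : E} (h : graphNorm D ξ ≤ 1) : ‖ξ‖ ≤ 1 := by
  rw [← ENNReal.ofReal_one, graphNorm_le_ofReal_iff zero_le_one] at h
  obtain ⟨_, h⟩ := h
  exact (le_add_of_nonneg_right (norm_nonneg _)).trans h

lemma norm_rep_apply_le {T : SpectralTriple.{u}} {x : T.A} (hx : ‖x‖ ≤ M) {ξ : T.E}
    (hξ : graphNorm T.D ξ ≤ 1) : ‖T.rep x ξ‖ ≤ M :=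
  (ContinuousLinearMap.le_of_opNorm_le_of_le _ ((NonUnitalStarAlgHom.norm_apply_le T.rep x).trans hx)
    (norm_le_one_of_graphNorm_le_one hξ)).trans (mul_one M).le

lemma IsLipschitzLift.norm_rep_calculus_le (h : IsLipschitzLift Q₁ Q₂ d b a M l)
    (hQ₁ : IsGraphQuotient P T₁ Q₁) (hQ₂ : IsGraphQuotient P T₂ Q₂)
    (hc : ‖(f - trigonometric c) * resolventFn‖ ≤ δ) (hN : ∀ t ∈ c.support, |t| ≤ N)
    (hω : graphNorm T₁.D ω ≤ 1) (hη : graphNorm T₂.D η ≤ 1)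
    (hωη : PairingClose Q₁ Q₂ N ε (T₁.rep b ω) (T₂.rep a η)) {ζ : P.M} (hζ : P.DN ζ ≤ 1) :
    ‖inner ℂ ω (T₁.rep b (T₁.calculus f (Q₁ ζ))) -
      inner ℂ η (T₂.rep a (T₂.calculus f (Q₂ ζ)))‖ ≤
      2 * M * δ + (∑ t ∈ c.support, ‖c t‖) * ε := by
  rw [← inner_rep_left (isSelfAdjoint_of_connesSeminorm_lt_top
      (h.L_left_le.trans_lt ENNReal.ofReal_lt_top)),
    ← inner_rep_left (isSelfAdjoint_of_connesSeminorm_lt_top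
      (h.L_right_le.trans_lt ENNReal.ofReal_lt_top))]
  exact hωη.norm_calculus_le hQ₁ hQ₂ hc hN (norm_rep_apply_le h.norm_left_le hω)
    (norm_rep_apply_le h.norm_right_le hη) hζ

/-- Here b Q₁ζ = Q₁(dζ) and a Q₂ζ = Q₂(dζ), so the estimate for f(D) is evaluated at dζ, of `DN` at
most C; ω and η need no change. -/
lemma IsLipschitzLift.norm_calculus_rep_le (hP : P.IsMetrical F K G H) (hG : 1 ≤ G)
    (h : IsLipschitzLift Q₁ Q₂ d b a M l) {C : ℝ} (hC : G * (M + l + 1) = C)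
    (hQ₁ : IsGraphQuotient P T₁ Q₁) (hQ₂ : IsGraphQuotient P T₂ Q₂)
    (hc : ‖(f - trigonometric c) * resolventFn‖ ≤ δ) (hN : ∀ t ∈ c.support, |t| ≤ N)
    (hω : graphNorm T₁.D ω ≤ 1) (hη : graphNorm T₂.D η ≤ 1)
    (hωη : PairingClose Q₁ Q₂ N ε ω η) {ζ : P.M} (hζ : P.DN ζ ≤ 1) :
    ‖inner ℂ ω (T₁.calculus f (T₁.rep b (Q₁ ζ))) -
      inner ℂ η (T₂.calculus f (T₂.rep a (Q₂ ζ)))‖ ≤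
      C * (2 * 1 * δ + (∑ t ∈ c.support, ‖c t‖) * ε) := by
  have hl := h.nonneg
  have hM : 0 ≤ M := (norm_nonneg d).trans h.norm_le
  have hC0 : 0 < C := by rw [← hC]; positivity
  have hd : P.DN (P.act d ζ) ≤ ENNReal.ofReal C :=
    (hP.DN_act_le (by linarith) hl h.L_le h.norm_le hζ).trans
      (ENNReal.ofReal_le_ofReal (by nlinarith))
  rw [← h.map_left, ← h.map_right]
  exact norm_pairing_le_of_DN_le hP (S₁ := T₁.calculus f ∘L Q₁) (S₂ := T₂.calculus f ∘L Q₂)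
    (fun ζ hζ => hωη.norm_calculus_le hQ₁ hQ₂ hc hN (norm_le_one_of_graphNorm_le_one hω)
      (norm_le_one_of_graphNorm_le_one hη) hζ) hC0 hd

end Bounds

lemma separation_le {τ : Tunnel F K G H T₁.mcc T₂.mcc} (hG : 1 ≤ G) {d : τ.P.A} {b : T₁.A}
    {a : T₂.A} {M l C : ℝ} (h : IsLipschitzLift τ.fst.onM τ.snd.onM d b a M l)
    (hC : G * (M + l + 1) = C) {N ε : ℝ} (hN : 0 ≤ N) (hε : 0 ≤ ε)
    (hτ : τ.separation (fun t : Set.Icc (-N) N => T₁.U t) (fun t : Set.Icc (-N) N => T₂.U t) <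
      ENNReal.ofReal ε) {f : ℝ →ᵇ ℂ} {c : ℝ →₀ ℂ} {δ : ℝ}
    (hc : ‖(f - trigonometric c) * resolventFn‖ ≤ δ) (hcN : ∀ t ∈ c.support, |t| ≤ N) :
    τ.separation (fun _ : Fin 1 => T₁.rep b ∘L T₁.calculus f)
        (fun _ : Fin 1 => T₂.rep a ∘L T₂.calculus f) ≤
      ENNReal.ofReal (2 * M * δ + (∑ t ∈ c.support, ‖c t‖) *
        (C * ε + √((2 * C + 1) * (2 * C * ε)))) ∧
    τ.separation (fun _ : Fin 1 => T₁.calculus f ∘L T₁.rep b)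
        (fun _ : Fin 1 => T₂.calculus f ∘L T₂.rep a) ≤
      ENNReal.ofReal (C * (2 * 1 * δ + (∑ t ∈ c.support, ‖c t‖) * ε)) := by
  have hl := h.nonneg
  have hM : 0 ≤ M := (norm_nonneg d).trans h.norm_le
  have hC0 : 0 < C := by rw [← hC]; positivity
  have hδ : 0 ≤ δ := (norm_nonneg _).trans hc
  have hP := τ.isMetrical
  have hQ₁ := τ.fst.isGraphQuotient
  have hQ₂ := τ.snd.isGraphQuotient
  obtain ⟨h₁, h₂⟩ := exists_familyClose_of_separation_lt hε hτ
  have k₁ : ∀ ω, graphNorm T₁.D ω ≤ 1 → ∃ η, graphNorm T₂.D η ≤ 1 ∧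
      PairingClose τ.fst.onM τ.snd.onM N ε ω η := fun ω hω => by
    obtain ⟨η, hη, hc⟩ := h₁ ω hω
    exact ⟨η, hη, fun t ht => hc ⟨t, abs_le.mp ht⟩⟩
  have k₂ : ∀ η, graphNorm T₂.D η ≤ 1 → ∃ ω, graphNorm T₁.D ω ≤ 1 ∧
      PairingClose τ.snd.onM τ.fst.onM N ε η ω := fun η hη => by
    obtain ⟨ω, hω, hc⟩ := h₂ η hη
    exact ⟨ω, hω, PairingClose.symm fun t ht => hc ⟨t, abs_le.mp ht⟩⟩
  constructor
  · refine separation_le_of_exists_familyClose (by positivity) (fun ω hω => ?_) (fun η hη => ?_)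
    · obtain ⟨η, hη, -, hωη⟩ := h.exists_pairingClose hP hG hQ₂ hC hN k₁ hω
      exact ⟨η, hη, fun _ ζ hζ => h.norm_rep_calculus_le hQ₁ hQ₂ hc hcN hω hη hωη hζ⟩
    -- All hypotheses are symmetric in the two triples, so the converse direction exchanges Q₁ and
    -- Q₂.
    · obtain ⟨ω, hω, -, hωη⟩ := h.symm.exists_pairingClose hP hG hQ₁ hC hN k₂ hη
      exact ⟨ω, hω, fun _ ζ hζ => h.norm_rep_calculus_le hQ₁ hQ₂ hc hcN hω hη hωη.symm hζ⟩
  · refine separation_le_of_exists_familyClose (by positivity) (fun ω hω => ?_) (fun η hη => ?_)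
    · obtain ⟨η, hη, hωη⟩ := k₁ ω hω
      exact ⟨η, hη, fun _ ζ hζ =>
        h.norm_calculus_rep_le hP hG hC hQ₁ hQ₂ hc hcN hω hη hωη hζ⟩
    · obtain ⟨ω, hω, hωη⟩ := k₂ η hη
      exact ⟨ω, hω, fun _ ζ hζ =>
        h.norm_calculus_rep_le hP hG hC hQ₁ hQ₂ hc hcN hω hη hωη.symm hζ⟩

/-- Needed to make every `μ n` strictly positive. -/
lemma spectralPropinquityStar_nonneg : 0 ≤ spectralPropinquityStar F K G H T₁ T₂ := by
  refine Real.sInf_nonneg ?_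
  rintro x (hx | hx)
  · rw [Set.mem_singleton_iff.mp hx]
    positivity
  · exact hx.1.le

end Main

end SpectralPropinquity

open SpectralPropinquity in
theorem mainTheorem10 (F K G H : ℝ) (hF : 1 ≤ F) (hK : 0 ≤ K) (hG : 1 ≤ G) (hH : 2 ≤ H)
    (T : ℕ → MetricSpectralTriple.{u}) (Tinf : MetricSpectralTriple.{u})
    (hconv : Tendsto (fun n => spectralPropinquity F K G H (T n).toSpectralTriple
      Tinf.toSpectralTriple) atTop (𝓝 0))
    (hlt : ∀ n, spectralPropinquityStar F K G H (T n).toSpectralTriple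
      Tinf.toSpectralTriple < √2 / 2)
    (μ : ℕ → ℝ)
    (hμ : ∀ n, spectralPropinquityStar F K G H (T n).toSpectralTriple
      Tinf.toSpectralTriple < μ n)
    (hμ0 : Tendsto μ atTop (𝓝 0))
    (τ : ∀ n, Tunnel F K G H (T n).mcc Tinf.mcc)
    (hτ : ∀ n, unitaryDispersion (τ n) (-1 / (2 * μ n)) (1 / (2 * μ n)) ≤ ENNReal.ofReal (μ n))
    (f : ℝ →ᵇ ℂ) (a : Tinf.A) (ha : Tinf.L a < ∞) (l : ℝ≥0) (hl : Tinf.L a ≤ l)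
    (b : ∀ n, (T n).A) (hb : ∀ n, b n ∈ (τ n).symm.targetSet a l) :
    Tendsto (fun n => opPropinquity F K G H (T n).mcc Tinf.mcc
      (fun _ : Fin 1 => (T n).rep (b n) ∘L (T n).calculus f)
      (fun _ : Fin 1 => Tinf.rep a ∘L Tinf.calculus f)) atTop (𝓝 0) ∧
    Tendsto (fun n => opPropinquity F K G H (T n).mcc Tinf.mcc
      (fun _ : Fin 1 => (T n).calculus f ∘L (T n).rep (b n))
      (fun _ : Fin 1 => Tinf.calculus f ∘L Tinf.rep a)) atTop (𝓝 0) := by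
  -- The bound l + 1 replaces l because rescaling by the Lipschitz bound needs it positive.
  set M : ℝ := ‖a‖ + ((l : ℝ) + 1)
  set C : ℝ := G * (M + ((l : ℝ) + 1) + 1) with hC
  have hM : 0 ≤ M := by positivity
  have hC0 : 0 ≤ C := by positivity
  have hμpos : ∀ n, 0 < μ n := fun n => spectralPropinquityStar_nonneg.trans_lt (hμ n)
  have key : ∀ e : ℝ≥0∞, 0 < e → ∀ᶠ n in atTop,
      opPropinquity F K G H (T n).mcc Tinf.mcc
        (fun _ : Fin 1 => (T n).rep (b n) ∘L (T n).calculus f)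
        (fun _ : Fin 1 => Tinf.rep a ∘L Tinf.calculus f) ≤ e ∧
      opPropinquity F K G H (T n).mcc Tinf.mcc
        (fun _ : Fin 1 => (T n).calculus f ∘L (T n).rep (b n))
        (fun _ : Fin 1 => Tinf.calculus f ∘L Tinf.rep a) ≤ e := by
    intro e he
    obtain ⟨r, hr0, hre⟩ := ENNReal.lt_iff_exists_nnreal_btwn.mp he
    have hr : 0 < (r : ℝ) := by exact_mod_cast hr0
    have hre' : ENNReal.ofReal (r : ℝ) ≤ e := by
      rw [ENNReal.ofReal_coe_nnreal]
      exact hre.le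
    -- With this δ both 2Mδ and 2Cδ, the limits of the two bounds as μₙ → 0, are below r.
    set δ : ℝ := r / (2 * (M + C + 1)) with hδ
    have hδ0 : 0 < δ := by positivity
    have hδr : 2 * (M + C + 1) * δ = r := by rw [hδ]; field_simp
    obtain ⟨c, hc⟩ := exists_trigonometric_near f hδ0
    set s : ℝ := ∑ t ∈ c.support, ‖c t‖
    have hlim : ∀ g : ℝ → ℝ, Continuous g → Tendsto (fun n => g (μ n)) atTop (𝓝 (g 0)) :=
      fun g hg => (hg.tendsto 0).comp hμ0
    -- The separation is at most μₙ, and ε = 2μₙ gives the strict inequality required.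
    have e1 := (hlim (fun x => 2 * M * δ + s * (C * (2 * x) +
      √((2 * C + 1) * (2 * C * (2 * x))))) (by fun_prop)).eventually_lt_const (u := (r : ℝ)) (by
        simp only [mul_zero, Real.sqrt_zero, add_zero]
        nlinarith)
    have e2 := (hlim (fun x => C * (2 * 1 * δ + s * (2 * x))) (by fun_prop)).eventually_lt_const
      (u := (r : ℝ)) (by
        simp only [mul_zero, add_zero]
        nlinarith)
    have e3 := (hlim (fun x => x) (by fun_prop)).eventually_lt_const hr
    have e4 := (hlim (fun x => x) (by fun_prop)).eventually_lt_const one_pos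
    -- This puts all frequencies of the polynomial in the window: each |t| is at most their sum,
    -- which is eventually below 1/(2μₙ).
    have e5 := (hlim (fun x => (∑ t ∈ c.support, |t|) * (2 * x)) (by fun_prop)).eventually_lt_const
      (u := 1) (by simp)
    filter_upwards [e1, e2, e3, e4, e5] with n h1 h2 h3 h4 h5
    have hp := hμpos n
    have hext : (τ n).extent ≤ ENNReal.ofReal (μ n) := (le_max_left _ _).trans (hτ n)
    have hsep := (le_max_right _ _).trans (hτ n)
    rw [neg_div] at hsep
    obtain ⟨d, hd1, hd2, hd3⟩ := hb n
    have hd : (τ n).P.L d ≤ ENNReal.ofReal ((l : ℝ) + 1) := by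
      refine hd2.trans ?_
      rw [← ENNReal.ofReal_coe_nnreal]
      exact ENNReal.ofReal_le_ofReal (by linarith)
    have hlift := (τ n).isLipschitzLift hd3 hd1 (by positivity) hd
      (hext.trans_lt (by rw [ENNReal.ofReal_lt_one]; exact h4))
    obtain ⟨s1, s2⟩ := separation_le hG hlift hC.symm (by positivity)
      (show 0 ≤ 2 * μ n by positivity)
      (hsep.trans_lt ((ENNReal.ofReal_lt_ofReal_iff (by positivity)).mpr (by linarith))) hc
      (fun t ht => by
        rw [le_div_iff₀ (by positivity)]
        refine le_trans ?_ h5.le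
        gcongr
        exact Finset.single_le_sum (f := fun t : ℝ => |t|) (fun _ _ => abs_nonneg _) ht)
    have hext' := (hext.trans (ENNReal.ofReal_le_ofReal h3.le)).trans hre'
    exact ⟨(iInf_le _ (τ n)).trans
        (max_le hext' ((s1.trans (ENNReal.ofReal_le_ofReal h1.le)).trans hre')),
      (iInf_le _ (τ n)).trans
        (max_le hext' ((s2.trans (ENNReal.ofReal_le_ofReal h2.le)).trans hre'))⟩
  exact ⟨ENNReal.tendsto_nhds_zero.mpr fun e he => (key e he).mono fun _ h => h.1,
    ENNReal.tendsto_nhds_zero.mpr fun e he => (key e he).mono fun _ h => h.2⟩
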